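/- **Setting.** Let $T\in\mathbb N\cup\{\infty\}$; the time set is $\mathbb T=\{0,\dots,T\}$ if $T<\infty$, and $\mathbb T=\mathbb N_0$ or $\mathbb T=\mathbb N_0\cup\{\infty\}$ if $T=\infty$; $\mathbb T_t=\{s\in\mathbb T: s\ge t\}$. Let $(\Omega,\mathcal F,(\mathcal F_t)_{t\in\mathbb T\cap\mathbb N_0},P)$ be a filtered probability space with $\mathcal F_0=\{\emptyset,\Omega\}$, and $\mathcal F_\infty=\sigma(\bigcup_{t\in\mathbb N_0}\mathcal F_t)$ if $T=\infty$; write $L^\infty_t=L^\infty(\Omega,\mathcal F_t,P)$. Let $\mathcal R^\infty$ be the space of adapted processes $X=(X_t)_{t\in\mathbb T}$ with $\sup_{t\in\mathbb T}|X_t|$ $P$-essentially bounded, let $\pi_{t,s}(X)_r=1_{\{t\le r\}}X_{r\wedge s}$, $\mathcal R^\infty_{t,s}=\pi_{t,s}(\mathcal R^\infty)$, $\mathcal R^\infty_t=\mathcal R^\infty_{t,T}$. (In)equalities between random variables are $P$-a.s. unless said otherwise. For each $t\in\mathbb T\cap\mathbb N_0$ let $\rho_t:\mathcal R^\infty_t\to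 L^\infty_t$ be a conditional convex risk measure for processes, i.e. for $X,Y\in\mathcal R_t^\infty$: $\rho_t(X+m1_{\mathbb T_t})=\rho_t(X)-m$ for $m\in L^\infty_t$; $\rho_t(X)\ge\rho_t(Y)$ if $X\le Y$; $\rho_t(\lambda X+(1-\lambda)Y)\le\lambda\rho_t(X)+(1-\lambda)\rho_t(Y)$ for $\lambda\in L^\infty_t$, $0\le\lambda\le1$; $\rho_t(0)=0$. Put $\rho_t(X):=\rho_t(\pi_{t,T}(X))$ for $X\in\mathcal R^\infty$. Assume that each $\rho_t$ is continuous from above ($\rho_t(X^n)\nearrow\rho_t(X)$ for every decreasing sequence $(X^n)\subset\mathcal R^\infty$ and $X\in\mathcal R^\infty$ with $X^n_s\searrow X_s$ for all $s\in\mathbb T_t$) and that $(\rho_t)$ is time consistent: for all $t\in\mathbb T$, $t<T$, and $X,Y\in\mathcal R^\infty$, if $X_t=Y_t$ and $\rho_{t+1}(X)\le\rho_{t+1}(Y)$, then $\rho_t(X)\le\rho_t(Y)$. Let $Q$ be a probability measure on $(\Omega,\mathcal F)$ with $Q\ll P$ on $\mathcal F_t$ for every $t\in\mathbb T\cap\mathbb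 N_0$, and $M_t=\frac{dQ}{dP}\big|_{\mathcal F_t}$. Let $D=(D_t)_{t\in\mathbb T}$ be a predictable discounting process for $Q$: $D_0=1$, $D$ is predictable, nonnegative and non-increasing $Q$-a.s.; if $\mathbb T=\mathbb N_0$, then $\lim_tD_t=0$ $Q$-a.s.; if $\mathbb T=\mathbb N_0\cup\{\infty\}$, then $D_\infty$ is $\mathcal F_\infty$-measurable, $D_\infty=\lim_tD_t$ $Q$-a.s., and $D_\infty=0$ $Q$-a.s. on $\{\lim_tM_t=\infty\}$. Put $\gamma_t=D_t-D_{t+1}$ for $t\in\mathbb T\cap\mathbb N_0$ (with $D_{T+1}:=0$ if $T<\infty$) and $\gamma_\infty=D_\infty$ if $\mathbb T=\mathbb N_0\cup\{\infty\}$. Let $\mathcal A_t=\{X\in\mathcal R^\infty_t:\rho_t(X)\le0\}$ and $\mathcal A_{t,t+1}=\{X\in\mathcal R^\infty_{t,t+1}:\rho_t(X)\le0\}$. The minimal penalty $\alpha_t=\alpha_t(Q\otimes D)$ and, for $t<T$, the one-step minimal penalty $\alpha_{t,t+1}=\alpha_{t,t+1}(Q\otimes D)$ are $$\alpha_t=Q\text{-}\operatorname*{ess\,sup}_{X\in\mathcal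 A_t}E_Q\Big[-\sum_{s\in\mathbb T_t}\frac{\gamma_s}{D_t}X_s\,\Big|\,\mathcal F_t\Big],\qquad \alpha_{t,t+1}=\frac1{D_t}\,Q\text{-}\operatorname*{ess\,sup}_{X\in\mathcal A_{t,t+1}}E_Q\big[-\gamma_tX_t-D_{t+1}X_{t+1}\,\big|\,\mathcal F_t\big]$$ on $\{D_t>0\}$, and $\alpha_t=\alpha_{t,t+1}=\infty$ on $\{D_t=0\}$, with the convention $0\cdot\infty=0$. Assume $\alpha_0(Q\otimes D)<\infty$. **Proposition.** The random variables $D_t\alpha_t$ ($t\in\mathbb T\cap\mathbb N_0$) and $D_t\alpha_{t,t+1}$ ($t<T$) are nonnegative and finite $Q$-a.s., the process $(D_t\alpha_t)_{t\in\mathbb T\cap\mathbb N_0}$ is a $Q$-supermartingale, and $$M_t^{Q,D}:=D_t\alpha_t+\sum_{k=0}^{t-1}D_k\alpha_{k,k+1},\qquad t\in\mathbb T\cap\mathbb N_0,$$ is a $Q$-martingale. The sum $\sum_{k=0}^{T-1}D_k\alpha_{k,k+1}$ is $Q$-a.s. finite and $Q$-integrable, and $$M_t^{Q,D}=E_Q\Big[\sum_{k=0}^{T-1}D_k\alpha_{k,k+1}\,\Big|\,\mathcal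 F_t\Big]+N_t^{Q,D}\quad Q\text{-a.s.},\quad t\in\mathbb T\cap\mathbb N_0,$$ where $N_t^{Q,D}:=0$ if $T<\infty$, while for $T=\infty$ the limit $N_t^{Q,D}:=\lim_{s\to\infty}E_Q[D_s\alpha_s\,|\,\mathcal F_t]$ exists $Q$-a.s.; $(N_t^{Q,D})_{t\in\mathbb T\cap\mathbb N_0}$ is a nonnegative $Q$-martingale. Consequently the Riesz decomposition of the $Q$-supermartingale $(D_t\alpha_t)$ into a potential and a martingale is $$D_t\alpha_t=S_t+N_t^{Q,D}\quad Q\text{-a.s.},\qquad S_t:=E_Q\Big[\sum_{k=t}^{T-1}D_k\alpha_{k,k+1}\,\Big|\,\mathcal F_t\Big],\quad t\in\mathbb T\cap\mathbb N_0,$$ where $(S_t)$ is a potential: a nonnegative $Q$-supermartingale with $\lim_{t\to\infty}E_Q[S_t]=0$ if $T=\infty$, and with $S_T=0$ $Q$-a.s. if $T<\infty$. -/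

import Mathlib

open MeasureTheory Filter Topology
open scoped ENNReal

/-! ### Essential suprema of families of random variables -/

/-- `g` is a version of the `μ`-essential supremum of the family `S` on the `σ`-field `m`:
the least `m`-measurable almost sure upper bound of `S`. -/
structure IsEssSupFamily {Ω : Type*} (m : MeasurableSpace Ω) {mΩ : MeasurableSpace Ω}
    (μ : Measure Ω) (S : Set (Ω → EReal)) (g : Ω → EReal) : Prop where
  measurable : Measurable[m] g
  le : ∀ f ∈ S, f ≤ᵐ[μ] g
  least : ∀ h : Ω → EReal, Measurable h → (∀ f ∈ S, f ≤ᵐ[μ] h) → g ≤ᵐ[μ] h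

theorem exists_isEssSupFamily {Ω : Type*} {m mΩ : MeasurableSpace Ω}
    (hm : m ≤ mΩ) (μ : Measure Ω) [IsFiniteMeasure μ] (S : Set (Ω → EReal))
    (hS : ∀ f ∈ S, Measurable[m] f) : ∃ g, IsEssSupFamily m μ S g := by
  classical
  set φ : EReal → ℝ≥0∞ := fun x => (ENNReal.orderIsoIicOneBirational (EReal.exp x) : ℝ≥0∞)
    with hφ
  have φmono : StrictMono φ := fun x y h =>
    ENNReal.orderIsoIicOneBirational.strictMono (EReal.exp_strictMono h)
  have φmeas : Measurable φ := φmono.monotone.measurable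
  have φle : ∀ x, φ x ≤ 1 := fun x => (ENNReal.orderIsoIicOneBirational (EReal.exp x)).2
  let G : Set (Ω → EReal) → Ω → EReal := fun C ω => ⨆ f ∈ C, f ω
  have Gmeas : ∀ C : Set (Ω → EReal), C.Countable → C ⊆ S → Measurable[m] (G C) :=
    fun C hC hCS => Measurable.biSup C hC (fun f hf => hS f (hCS hf))
  have Gmono : ∀ {C C' : Set (Ω → EReal)}, C ⊆ C' → ∀ ω, G C ω ≤ G C' ω :=
    fun h ω => biSup_mono h
  let I : Set (Ω → EReal) → ℝ≥0∞ := fun C => ∫⁻ ω, φ (G C ω) ∂μ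
  have Imono : ∀ {C C' : Set (Ω → EReal)}, C ⊆ C' → I C ≤ I C' :=
    fun h => lintegral_mono fun ω => φmono.monotone (Gmono h ω)
  let V : Set ℝ≥0∞ := I '' {C | C.Countable ∧ C ⊆ S}
  have hVne : V.Nonempty := ⟨I ∅, ∅, ⟨Set.countable_empty, Set.empty_subset _⟩, rfl⟩
  obtain ⟨u, -, hu, huV⟩ := exists_seq_tendsto_sSup hVne (OrderTop.bddAbove V)
  choose C hC hCu using huV
  let C0 : Set (Ω → EReal) := ⋃ n, C n
  have hC0 : C0.Countable := Set.countable_iUnion fun n => (hC n).1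
  have hC0S : C0 ⊆ S := Set.iUnion_subset fun n => (hC n).2
  have hmax : sSup V ≤ I C0 := by
    refine le_of_tendsto' hu fun n => ?_
    rw [← hCu n]
    exact Imono (Set.subset_iUnion C n)
  refine ⟨G C0, Gmeas C0 hC0 hC0S, fun f hf => ?_, fun h _ hh => ?_⟩
  · have hins : (insert f C0).Countable := hC0.insert f
    have hinsS : insert f C0 ⊆ S := Set.insert_subset hf hC0S
    have hle : I (insert f C0) ≤ I C0 :=
      le_trans (le_sSup (show I (insert f C0) ∈ V from ⟨_, ⟨hins, hinsS⟩, rfl⟩)) hmax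
    have hfin : I C0 ≠ ∞ := by
      refine ne_top_of_le_ne_top (measure_ne_top μ Set.univ) ?_
      calc I C0 ≤ ∫⁻ _, 1 ∂μ := lintegral_mono fun ω => φle _
        _ = μ Set.univ := by simp
    have hmeas : Measurable (G (insert f C0)) := (Gmeas _ hins hinsS).mono hm le_rfl
    have key := ae_eq_of_ae_le_of_lintegral_le
      (Eventually.of_forall fun ω => φmono.monotone (Gmono (Set.subset_insert f C0) ω))
      hfin (φmeas.comp hmeas).aemeasurable hle
    filter_upwards [key] with ω hω
    have h1 : G C0 ω = G (insert f C0) ω := φmono.injective hω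
    rw [h1]
    exact le_biSup (fun f : Ω → EReal => f ω) (Set.mem_insert f C0)
  · have : ∀ᵐ ω ∂μ, ∀ f ∈ C0, f ω ≤ h ω :=
      (ae_ball_iff hC0).2 fun f hf => hh f (hC0S hf)
    filter_upwards [this] with ω hω
    exact iSup₂_le hω

open Classical in
/-- A version of the `μ`-essential supremum of the family `S` on the `σ`-field `m`; it exists
whenever `S` consists of `m`-measurable functions. -/
noncomputable def essSupFamily {Ω : Type*} (m : MeasurableSpace Ω) {mΩ : MeasurableSpace Ω}
    (μ : Measure Ω) (S : Set (Ω → EReal)) : Ω → EReal :=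
  if h : ∃ g, IsEssSupFamily m μ S g then h.choose else fun _ => ⊥

theorem isEssSupFamily_essSupFamily {Ω : Type*} {m mΩ : MeasurableSpace Ω}
    (hm : m ≤ mΩ) (μ : Measure Ω) [IsFiniteMeasure μ] (S : Set (Ω → EReal))
    (hS : ∀ f ∈ S, Measurable[m] f) : IsEssSupFamily m μ S (essSupFamily m μ S) := by
  have h := exists_isEssSupFamily hm μ S hS
  rw [essSupFamily, dif_pos h]
  exact h.choose_spec

/-! ### Time sets, filtrations and processes -/

/-- The three kinds of time sets: `{0, …, T}`, `ℕ` and `ℕ ∪ {∞}`. -/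
inductive Horizon : Type
  | finite (T : ℕ) : Horizon
  | nat : Horizon
  | natInfty : Horizon

namespace Horizon

/-- The set `𝕋` of time points. -/
def times : Horizon → Set ℕ∞
  | finite T => {t | t ≤ (T : ℕ∞)}
  | nat => {t | t ≠ ⊤}
  | natInfty => Set.univ

/-- The time horizon `T ∈ ℕ ∪ {∞}`. -/
def last : Horizon → ℕ∞
  | finite T => (T : ℕ∞)
  | nat => ⊤
  | natInfty => ⊤

/-- `𝕋_t = {s ∈ 𝕋 | s ≥ t}`. -/
def timesFrom (H : Horizon) (t : ℕ) : Set ℕ∞ := {s | s ∈ H.times ∧ (t : ℕ∞) ≤ s}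

/-- The type of finite time points, `𝕋 ∩ ℕ`. -/
abbrev NatTime (H : Horizon) : Type := {t : ℕ // (t : ℕ∞) ∈ H.times}

end Horizon

/-- The filtration `(ℱ_t)` restricted to the finite time points `t ∈ 𝕋 ∩ ℕ`. (For a finite
horizon the `σ`-fields beyond the horizon play no role anywhere.) -/
def filtrationOn {Ω : Type*} {mΩ : MeasurableSpace Ω} (H : Horizon) (ℱ : Filtration ℕ mΩ) :
    Filtration H.NatTime mΩ where
  seq t := ℱ t.1
  mono' _ _ h := ℱ.mono h
  le' t := ℱ.le t.1

/-- The `σ`-field `ℱ_t` for `t ∈ ℕ ∪ {∞}`, where `ℱ_∞ = σ(⋃ₙ ℱ_n)`. -/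
@[reducible] def sigmaAt {Ω : Type*} {mΩ : MeasurableSpace Ω} (ℱ : Filtration ℕ mΩ) (t : ℕ∞) :
    MeasurableSpace Ω :=
  ⨆ (n : ℕ) (_ : (n : ℕ∞) ≤ t), ℱ n

theorem sigmaAt_coe {Ω : Type*} {mΩ : MeasurableSpace Ω} (ℱ : Filtration ℕ mΩ) (n : ℕ) :
    sigmaAt ℱ (n : ℕ∞) = ℱ n :=
  le_antisymm (iSup₂_le fun _ hk => ℱ.mono (by exact_mod_cast hk))
    (le_iSup₂_of_le n le_rfl le_rfl)

theorem sigmaAt_top {Ω : Type*} {mΩ : MeasurableSpace Ω} (ℱ : Filtration ℕ mΩ) :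
    sigmaAt ℱ ⊤ = ⨆ n, ℱ n := by
  simp [sigmaAt]

/-- `f ∈ L^∞(Ω, m, P)`. -/
def MemLinfty {Ω : Type*} (m : MeasurableSpace Ω) {mΩ : MeasurableSpace Ω}
    (P : Measure Ω) (f : Ω → ℝ) : Prop :=
  Measurable[m] f ∧ ∃ C : ℝ, ∀ᵐ ω ∂P, |f ω| ≤ C

/-- `X ∈ ℛ^∞`: `X` is adapted and `sup_{t ∈ 𝕋} |X_t|` is essentially bounded. Only the values
`X_t` with `t ∈ 𝕋` matter. -/
def MemR {Ω : Type*} {mΩ : MeasurableSpace Ω} (H : Horizon) (ℱ : Filtration ℕ mΩ) (P : Measure Ω)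
    (X : ℕ∞ → Ω → ℝ) : Prop :=
  (∀ t ∈ H.times, Measurable[sigmaAt ℱ t] (X t)) ∧
    ∃ C : ℝ, ∀ᵐ ω ∂P, ∀ t ∈ H.times, |X t ω| ≤ C

/-- The projection `π_{t,s}(X)_r = 1_{t ≤ r} X_{r ∧ s}`. -/
noncomputable def proj {Ω : Type*} (t : ℕ) (s : ℕ∞) (X : ℕ∞ → Ω → ℝ) : ℕ∞ → Ω → ℝ :=
  fun r ω => if (t : ℕ∞) ≤ r then X (min r s) ω else 0

/-- `X ∈ ℛ^∞_{t,s} = π_{t,s}(ℛ^∞)`, up to almost sure equality. -/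
def MemRange {Ω : Type*} {mΩ : MeasurableSpace Ω} (H : Horizon) (ℱ : Filtration ℕ mΩ)
    (P : Measure Ω) (t : ℕ) (s : ℕ∞) (X : ℕ∞ → Ω → ℝ) : Prop :=
  MemR H ℱ P X ∧ ∀ r ∈ H.times, X r =ᵐ[P] proj t s X r

/-- `X ∈ ℛ^∞_t = π_{t,T}(ℛ^∞)`. -/
def MemRFrom {Ω : Type*} {mΩ : MeasurableSpace Ω} (H : Horizon) (ℱ : Filtration ℕ mΩ)
    (P : Measure Ω) (t : ℕ) (X : ℕ∞ → Ω → ℝ) : Prop :=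
  MemRange H ℱ P t H.last X

/-! ### Risk measures for processes

A risk measure acts on representatives; monotonicity, required for almost sure inequalities,
makes it respect almost sure equality of processes. -/

/-- `ρ` is a conditional convex risk measure for processes at time `t`, `ρ : ℛ^∞_t → L^∞_t`. -/
structure IsCondConvexRiskMeasure {Ω : Type*} {mΩ : MeasurableSpace Ω} (H : Horizon)
    (ℱ : Filtration ℕ mΩ) (P : Measure Ω) (t : ℕ) (ρ : (ℕ∞ → Ω → ℝ) → Ω → ℝ) : Prop where
  memLinfty : ∀ X, MemRFrom H ℱ P t X → MemLinfty (ℱ t) P (ρ X)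
  cash_invariance : ∀ X, MemRFrom H ℱ P t X → ∀ c : Ω → ℝ, MemLinfty (ℱ t) P c →
    ρ (fun s ω => X s ω + if (t : ℕ∞) ≤ s then c ω else 0) =ᵐ[P] fun ω => ρ X ω - c ω
  monotone : ∀ X Y, MemRFrom H ℱ P t X → MemRFrom H ℱ P t Y →
    (∀ s ∈ H.times, X s ≤ᵐ[P] Y s) → ρ Y ≤ᵐ[P] ρ X
  convex : ∀ X Y, MemRFrom H ℱ P t X → MemRFrom H ℱ P t Y →
    ∀ l : Ω → ℝ, MemLinfty (ℱ t) P l → (∀ᵐ ω ∂P, 0 ≤ l ω ∧ l ω ≤ 1) →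
    ρ (fun s ω => l ω * X s ω + (1 - l ω) * Y s ω) ≤ᵐ[P]
      fun ω => l ω * ρ X ω + (1 - l ω) * ρ Y ω
  normalized : ρ (fun _ _ => 0) =ᵐ[P] fun _ => 0

/-- `(ρ_t)_{t ∈ 𝕋 ∩ ℕ}` is a dynamic convex risk measure for processes. -/
def IsDynConvexRiskMeasure {Ω : Type*} {mΩ : MeasurableSpace Ω} (H : Horizon)
    (ℱ : Filtration ℕ mΩ) (P : Measure Ω) (ρ : ℕ → (ℕ∞ → Ω → ℝ) → Ω → ℝ) : Prop :=
  ∀ t : ℕ, (t : ℕ∞) ∈ H.times → IsCondConvexRiskMeasure H ℱ P t (ρ t)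

/-- `ρ_t(X) := ρ_t(π_{t,T}(X))` for `X ∈ ℛ^∞`. -/
noncomputable def riskOf {Ω : Type*} (H : Horizon) (ρ : ℕ → (ℕ∞ → Ω → ℝ) → Ω → ℝ) (t : ℕ)
    (X : ℕ∞ → Ω → ℝ) : Ω → ℝ :=
  ρ t (proj t H.last X)

/-- Continuity from above of `ρ_t`. -/
def IsContinuousFromAbove {Ω : Type*} {mΩ : MeasurableSpace Ω} (H : Horizon)
    (ℱ : Filtration ℕ mΩ) (P : Measure Ω) (ρ : ℕ → (ℕ∞ → Ω → ℝ) → Ω → ℝ) (t : ℕ) : Prop :=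
  ∀ (X : ℕ → ℕ∞ → Ω → ℝ) (Y : ℕ∞ → Ω → ℝ), (∀ n, MemR H ℱ P (X n)) → MemR H ℱ P Y →
    (∀ n, ∀ s ∈ H.times, X (n + 1) s ≤ᵐ[P] X n s) →
    (∀ s ∈ H.timesFrom t, ∀ᵐ ω ∂P, Tendsto (fun n => X n s ω) atTop (𝓝 (Y s ω))) →
    ∀ᵐ ω ∂P, Monotone (fun n => riskOf H ρ t (X n) ω) ∧
      Tendsto (fun n => riskOf H ρ t (X n) ω) atTop (𝓝 (riskOf H ρ t Y ω))

/-- (Strong) time consistency. -/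
def IsTimeConsistent {Ω : Type*} {mΩ : MeasurableSpace Ω} (H : Horizon)
    (ℱ : Filtration ℕ mΩ) (P : Measure Ω) (ρ : ℕ → (ℕ∞ → Ω → ℝ) → Ω → ℝ) : Prop :=
  ∀ t : ℕ, (t : ℕ∞) < H.last → ∀ X Y, MemR H ℱ P X → MemR H ℱ P Y →
    X t =ᵐ[P] Y t → riskOf H ρ (t + 1) X ≤ᵐ[P] riskOf H ρ (t + 1) Y →
    riskOf H ρ t X ≤ᵐ[P] riskOf H ρ t Y

/-- The acceptance set `𝒜_t = {X ∈ ℛ^∞_t | ρ_t(X) ≤ 0}`. -/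
def acceptanceSet {Ω : Type*} {mΩ : MeasurableSpace Ω} (H : Horizon) (ℱ : Filtration ℕ mΩ)
    (P : Measure Ω) (ρ : ℕ → (ℕ∞ → Ω → ℝ) → Ω → ℝ) (t : ℕ) : Set (ℕ∞ → Ω → ℝ) :=
  {X | MemRFrom H ℱ P t X ∧ ∀ᵐ ω ∂P, ρ t X ω ≤ 0}

/-- The one-step acceptance set `𝒜_{t,t+1} = {X ∈ ℛ^∞_{t,t+1} | ρ_t(X) ≤ 0}`. -/
def acceptanceSetOneStep {Ω : Type*} {mΩ : MeasurableSpace Ω} (H : Horizon)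
    (ℱ : Filtration ℕ mΩ) (P : Measure Ω) (ρ : ℕ → (ℕ∞ → Ω → ℝ) → Ω → ℝ) (t : ℕ) :
    Set (ℕ∞ → Ω → ℝ) :=
  {X | MemRange H ℱ P t ((t + 1 : ℕ) : ℕ∞) X ∧ ∀ᵐ ω ∂P, ρ t X ω ≤ 0}

/-! ### Models and discounting processes -/

/-- `Q ∈ ℳ_loc(P)`: `Q ≪ P` on `ℱ_t` for each `t ∈ 𝕋 ∩ ℕ`. -/
def IsLocAbsCont {Ω : Type*} {mΩ : MeasurableSpace Ω} (H : Horizon) (ℱ : Filtration ℕ mΩ)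
    (P Q : Measure Ω) : Prop :=
  ∀ n : ℕ, (n : ℕ∞) ∈ H.times → Q.trim (ℱ.le n) ≪ P.trim (ℱ.le n)

/-- The density process `M_n = dQ/dP` on `ℱ_n`. -/
noncomputable def densityProcess {Ω : Type*} {mΩ : MeasurableSpace Ω} (ℱ : Filtration ℕ mΩ)
    (P Q : Measure Ω) (n : ℕ) : Ω → ℝ≥0∞ :=
  (Q.trim (ℱ.le n)).rnDeriv (P.trim (ℱ.le n))

/-- `D ∈ 𝒟(Q)`: `D` is a predictable discounting process. -/
structure IsDiscounting {Ω : Type*} {mΩ : MeasurableSpace Ω} (H : Horizon)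
    (ℱ : Filtration ℕ mΩ) (P Q : Measure Ω) (D : ℕ∞ → Ω → ℝ) : Prop where
  zero : ∀ ω, D 0 ω = 1
  predictable : ∀ n : ℕ, ((n + 1 : ℕ) : ℕ∞) ∈ H.times → Measurable[ℱ n] (D (n + 1 : ℕ))
  nonneg : ∀ t ∈ H.times, ∀ᵐ ω ∂Q, 0 ≤ D t ω
  nonincreasing : ∀ n : ℕ, ((n + 1 : ℕ) : ℕ∞) ∈ H.times → D (n + 1 : ℕ) ≤ᵐ[Q] D n
  /-- For `𝕋 = ℕ`: `D_∞ = lim D_t = 0`. -/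
  tendsto_nat : H = Horizon.nat →
    ∀ᵐ ω ∂Q, Tendsto (fun n : ℕ => D n ω) atTop (𝓝 0)
  measurable_infty : H = Horizon.natInfty → Measurable[sigmaAt ℱ ⊤] (D ⊤)
  /-- For `𝕋 = ℕ ∪ {∞}`: `D_∞ = lim D_t`. -/
  tendsto_infty : H = Horizon.natInfty →
    ∀ᵐ ω ∂Q, Tendsto (fun n : ℕ => D n ω) atTop (𝓝 (D ⊤ ω))
  /-- For `𝕋 = ℕ ∪ {∞}`: `D_∞ = 0` on `{M_∞ = ∞}`, where `M_∞ = lim M_n`. -/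
  infty_eq_zero : H = Horizon.natInfty →
    ∀ᵐ ω ∂Q, Tendsto (fun n => densityProcess ℱ P Q n ω) atTop (𝓝 ∞) → D ⊤ ω = 0

/-- The optional random measure `γ` of `D`: `γ_t = D_t - D_{t+1}`, with `D_{T+1} = 0` if `T < ∞`,
and `γ_∞ = D_∞`. -/
noncomputable def gammaOf {Ω : Type*} (H : Horizon) (D : ℕ∞ → Ω → ℝ) (t : ℕ∞) (ω : Ω) : ℝ :=
  if t = H.last then D t ω else D t ω - D (t + 1) ω

/-! ### Penalties -/

open Classical in
/-- The minimal penalty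
`α_t(Q ⊗ D) = Q-ess sup_{X ∈ 𝒜_t} E_Q[-∑_{s ∈ 𝕋_t} (γ_s / D_t) X_s | ℱ_t]` on `{D_t > 0}`,
and `α_t(Q ⊗ D) = ∞` on `{D_t = 0}`. -/
noncomputable def penalty {Ω : Type*} {mΩ : MeasurableSpace Ω} (H : Horizon)
    (ℱ : Filtration ℕ mΩ) (P : Measure Ω) (ρ : ℕ → (ℕ∞ → Ω → ℝ) → Ω → ℝ)
    (Q : Measure Ω) (D : ℕ∞ → Ω → ℝ) (t : ℕ) (ω : Ω) : EReal :=
  if 0 < D t ω then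
    essSupFamily (ℱ t) Q
      ((fun (X : ℕ∞ → Ω → ℝ) (ω' : Ω) =>
          (((Q[fun ω'' => -∑' s : H.timesFrom t, gammaOf H D s ω'' / D t ω'' * X s ω'' | ℱ t]) ω'
            : ℝ) : EReal)) '' acceptanceSet H ℱ P ρ t) ω
  else ⊤

open Classical in
/-- The one-step minimal penalty
`α_{t,t+1}(Q ⊗ D) = (1 / D_t) Q-ess sup_{X ∈ 𝒜_{t,t+1}} E_Q[-γ_t X_t - D_{t+1} X_{t+1} | ℱ_t]`
on `{D_t > 0}`, and `α_{t,t+1}(Q ⊗ D) = ∞` on `{D_t = 0}` (for `t < T`). -/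
noncomputable def penaltyOneStep {Ω : Type*} {mΩ : MeasurableSpace Ω} (H : Horizon)
    (ℱ : Filtration ℕ mΩ) (P : Measure Ω) (ρ : ℕ → (ℕ∞ → Ω → ℝ) → Ω → ℝ)
    (Q : Measure Ω) (D : ℕ∞ → Ω → ℝ) (t : ℕ) (ω : Ω) : EReal :=
  if 0 < D t ω then
    ((1 / D t ω : ℝ) : EReal) * essSupFamily (ℱ t) Q
      ((fun (X : ℕ∞ → Ω → ℝ) (ω' : Ω) =>
          (((Q[fun ω'' => -gammaOf H D t ω'' * X t ω''
              - D (t + 1 : ℕ) ω'' * X (t + 1 : ℕ) ω'' | ℱ t]) ω' : ℝ) : EReal)) ''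
        acceptanceSetOneStep H ℱ P ρ t) ω
  else ⊤

/-- The discounted penalty `D_t α_t(Q ⊗ D)`, with `0 · ∞ = 0`. -/
noncomputable def discPenalty {Ω : Type*} {mΩ : MeasurableSpace Ω} (H : Horizon)
    (ℱ : Filtration ℕ mΩ) (P : Measure Ω) (ρ : ℕ → (ℕ∞ → Ω → ℝ) → Ω → ℝ)
    (Q : Measure Ω) (D : ℕ∞ → Ω → ℝ) (t : ℕ) (ω : Ω) : EReal :=
  (D t ω : EReal) * penalty H ℱ P ρ Q D t ω

/-- The discounted one-step penalty `D_t α_{t,t+1}(Q ⊗ D)`, with `0 · ∞ = 0`. -/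
noncomputable def discPenaltyOneStep {Ω : Type*} {mΩ : MeasurableSpace Ω} (H : Horizon)
    (ℱ : Filtration ℕ mΩ) (P : Measure Ω) (ρ : ℕ → (ℕ∞ → Ω → ℝ) → Ω → ℝ)
    (Q : Measure Ω) (D : ℕ∞ → Ω → ℝ) (t : ℕ) (ω : Ω) : EReal :=
  (D t ω : EReal) * penaltyOneStep H ℱ P ρ Q D t ω

/-- The real-valued process `V_t = D_t α_t(Q ⊗ D)` (the discounted penalties of interest are
almost surely finite). -/
noncomputable def penaltyProcess {Ω : Type*} {mΩ : MeasurableSpace Ω} (H : Horizon)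
    (ℱ : Filtration ℕ mΩ) (P : Measure Ω) (ρ : ℕ → (ℕ∞ → Ω → ℝ) → Ω → ℝ)
    (Q : Measure Ω) (D : ℕ∞ → Ω → ℝ) (t : ℕ) (ω : Ω) : ℝ :=
  (discPenalty H ℱ P ρ Q D t ω).toReal

/-- The real-valued random variable `D_k α_{k,k+1}(Q ⊗ D)` for `k < T`, extended by `0` to
`k ≥ T`, so that a sum over `k ≤ T - 1` is a sum over all `k`. -/
noncomputable def stepTerm {Ω : Type*} {mΩ : MeasurableSpace Ω} (H : Horizon)
    (ℱ : Filtration ℕ mΩ) (P : Measure Ω) (ρ : ℕ → (ℕ∞ → Ω → ℝ) → Ω → ℝ)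
    (Q : Measure Ω) (D : ℕ∞ → Ω → ℝ) (k : ℕ) (ω : Ω) : ℝ :=
  if (k : ℕ∞) < H.last then (discPenaltyOneStep H ℱ P ρ Q D k ω).toReal else 0

/-- The process `M_t = D_t α_t(Q ⊗ D) + ∑_{k=0}^{t-1} D_k α_{k,k+1}(Q ⊗ D)`. -/
noncomputable def doobMartingale {Ω : Type*} {mΩ : MeasurableSpace Ω} (H : Horizon)
    (ℱ : Filtration ℕ mΩ) (P : Measure Ω) (ρ : ℕ → (ℕ∞ → Ω → ℝ) → Ω → ℝ)
    (Q : Measure Ω) (D : ℕ∞ → Ω → ℝ) (t : ℕ) (ω : Ω) : ℝ :=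
  penaltyProcess H ℱ P ρ Q D t ω + ∑ k ∈ Finset.range t, stepTerm H ℱ P ρ Q D k ω

/-- The total penalty from time `t` on, `∑_{k=t}^{T-1} D_k α_{k,k+1}(Q ⊗ D)`. -/
noncomputable def stepSumFrom {Ω : Type*} {mΩ : MeasurableSpace Ω} (H : Horizon)
    (ℱ : Filtration ℕ mΩ) (P : Measure Ω) (ρ : ℕ → (ℕ∞ → Ω → ℝ) → Ω → ℝ)
    (Q : Measure Ω) (D : ℕ∞ → Ω → ℝ) (t : ℕ) (ω : Ω) : ℝ :=
  ∑' k : ℕ, if t ≤ k then stepTerm H ℱ P ρ Q D k ω else 0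

/-- `S` is a nonnegative supermartingale that vanishes at the horizon: `E_Q[S_t] → 0` if `T = ∞`
(a `Q`-potential), and `S_T = 0` if `T < ∞`. -/
def IsPotential {Ω : Type*} {mΩ : MeasurableSpace Ω} (H : Horizon) (ℱ : Filtration ℕ mΩ)
    (Q : Measure Ω) (S : ℕ → Ω → ℝ) : Prop :=
  Supermartingale (fun t : H.NatTime => S t) (filtrationOn H ℱ) Q ∧
    (∀ t : H.NatTime, 0 ≤ᵐ[Q] S t) ∧
    (H.last = ⊤ → Tendsto (fun t : ℕ => ∫ ω, S t ω ∂Q) atTop (𝓝 0)) ∧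
    (∀ T : ℕ, H.last = T → S T =ᵐ[Q] 0)

/-! ### Essential suprema of directed families -/

/-! Write `V t` for `D_t α_t` and `c t` for `D_t α_{t,t+1}`. Everything follows from the one-step
identity `V t = c t + E_Q[V (t+1) | ℱ t]`.

Time consistency and cash invariance give `𝒜_t = 𝒜_{t,t+1} + 𝒜_{t+1}` (`add_mem_acceptanceSet`,
`exists_add_of_mem_acceptanceSet`). The conditional loss `E_Q[-∑ γ_s X_s | ℱ t]` splits along such a
sum by the tower property (`condLoss_add`). The losses of acceptable processes are upward directed,
because acceptable processes can be pasted along events of `ℱ t`. Their essential supremum is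
therefore an increasing limit and commutes with conditional expectation. Taking suprema over both
summands gives the identity (`discPenalty_succ`). Since `ℱ 0` is trivial, `α_0 < ∞` makes `V 0` a
finite constant, and the identity carries finiteness and integrability forward in time.

The rest is abstract (`IsCostRecursion`). The recursion says that `V t + ∑_{k<t} c k` is a
martingale. Its constant mean bounds the expectation of every partial sum of costs, so the total
cost is integrable. Subtracting the closed martingale `E_Q[∑ c k | ℱ t]` leaves the martingale `N`,
which by monotone convergence is `lim_s E_Q[V s | ℱ t]`, while the expected remaining cost is the
potential. A finite horizon is included by extending `V` and `c` by zero, which is consistent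
because `V T = 0`.

One point needs care: `Q ≪ P` holds only on each `ℱ t`, so `P`-a.s. statements at time infinity need
not hold `Q`-a.s. A `P`-null event of `ℱ_∞` lies `Q`-a.s. in `{lim M_t = ∞}`, where `D_∞` vanishes.
Exceptional values are thus never weighted by `γ`. -/

theorem IsEssSupFamily.exists_countable {Ω : Type*} {m mΩ : MeasurableSpace Ω}
    (hm : m ≤ mΩ) {μ : Measure Ω} [IsFiniteMeasure μ] {S : Set (Ω → EReal)} {g : Ω → EReal}
    (hg : IsEssSupFamily m μ S g) (hS : ∀ f ∈ S, Measurable[m] f) :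
    ∃ C : Set (Ω → EReal), C.Countable ∧ C ⊆ S ∧ g ≤ᵐ[μ] fun ω => ⨆ f ∈ C, f ω := by
  classical
  -- A strictly increasing map into `[0, 1]`: integrals become finite, yet equality after `φ` still
  -- forces equality before it.
  set φ : EReal → ℝ≥0∞ := fun x => (ENNReal.orderIsoIicOneBirational (EReal.exp x) : ℝ≥0∞)
    with hφ
  have φmono : StrictMono φ := fun x y h =>
    ENNReal.orderIsoIicOneBirational.strictMono (EReal.exp_strictMono h)
  have φmeas : Measurable φ := φmono.monotone.measurable
  have φle : ∀ x, φ x ≤ 1 := fun x => (ENNReal.orderIsoIicOneBirational (EReal.exp x)).2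
  let G : Set (Ω → EReal) → Ω → EReal := fun C ω => ⨆ f ∈ C, f ω
  have Gmeas : ∀ C : Set (Ω → EReal), C.Countable → C ⊆ S → Measurable (G C) :=
    fun C hC hCS => Measurable.biSup C hC (fun f hf => (hS f (hCS hf)).mono hm le_rfl)
  have Gmono : ∀ {C C' : Set (Ω → EReal)}, C ⊆ C' → ∀ ω, G C ω ≤ G C' ω :=
    fun h ω => biSup_mono h
  let I : Set (Ω → EReal) → ℝ≥0∞ := fun C => ∫⁻ ω, φ (G C ω) ∂μ
  have Imono : ∀ {C C' : Set (Ω → EReal)}, C ⊆ C' → I C ≤ I C' :=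
    fun h => lintegral_mono fun ω => φmono.monotone (Gmono h ω)
  let V : Set ℝ≥0∞ := I '' {C | C.Countable ∧ C ⊆ S}
  have hVne : V.Nonempty := ⟨I ∅, ∅, ⟨Set.countable_empty, Set.empty_subset _⟩, rfl⟩
  obtain ⟨u, -, hu, huV⟩ := exists_seq_tendsto_sSup hVne (OrderTop.bddAbove V)
  choose C hC hCu using huV
  let C0 : Set (Ω → EReal) := ⋃ n, C n
  have hC0 : C0.Countable := Set.countable_iUnion fun n => (hC n).1
  have hC0S : C0 ⊆ S := Set.iUnion_subset fun n => (hC n).2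
  have hmax : sSup V ≤ I C0 := by
    refine le_of_tendsto' hu fun n => ?_
    rw [← hCu n]
    exact Imono (Set.subset_iUnion C n)
  -- `C0` maximises the integral of `φ ∘ sup` over countable subfamilies. Adjoining any `f` cannot
  -- raise it, so `f ≤ sup C0` almost everywhere.
  refine ⟨C0, hC0, hC0S, hg.least _ (Gmeas C0 hC0 hC0S) fun f hf => ?_⟩
  have hins : (insert f C0).Countable := hC0.insert f
  have hinsS : insert f C0 ⊆ S := Set.insert_subset hf hC0S
  have hle : I (insert f C0) ≤ I C0 :=
    le_trans (le_sSup (show I (insert f C0) ∈ V from ⟨_, ⟨hins, hinsS⟩, rfl⟩)) hmax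
  have hfin : I C0 ≠ ∞ := by
    refine ne_top_of_le_ne_top (measure_ne_top μ Set.univ) ?_
    calc I C0 ≤ ∫⁻ _, 1 ∂μ := lintegral_mono fun ω => φle _
      _ = μ Set.univ := by simp
  have key := ae_eq_of_ae_le_of_lintegral_le
    (Eventually.of_forall fun ω => φmono.monotone (Gmono (Set.subset_insert f C0) ω))
    hfin (φmeas.comp (Gmeas _ hins hinsS)).aemeasurable hle
  filter_upwards [key] with ω hω
  have h1 : G C0 ω = G (insert f C0) ω := φmono.injective hω
  change f ω ≤ G C0 ω
  rw [h1]
  exact le_biSup (fun f : Ω → EReal => f ω) (Set.mem_insert f C0)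

/-- The essential supremum of an upward directed family is the limit of an increasing sequence
from the family, with a prescribed first member. -/
theorem IsEssSupFamily.exists_seq {Ω : Type*} {m mΩ : MeasurableSpace Ω}
    (hm : m ≤ mΩ) {μ : Measure Ω} [IsFiniteMeasure μ] {S : Set (Ω → EReal)} {g : Ω → EReal}
    (hg : IsEssSupFamily m μ S g) (hS : ∀ f ∈ S, Measurable[m] f)
    (hdir : ∀ f ∈ S, ∀ f' ∈ S, ∃ h ∈ S, f ≤ᵐ[μ] h ∧ f' ≤ᵐ[μ] h)
    {f₀ : Ω → EReal} (hf₀ : f₀ ∈ S) :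
    ∃ f : ℕ → Ω → EReal, f 0 = f₀ ∧ (∀ n, f n ∈ S) ∧ (∀ n, f n ≤ᵐ[μ] f (n + 1)) ∧
      ∀ᵐ ω ∂μ, ⨆ n, f n ω = g ω := by
  obtain ⟨C, hC, hCS, hgC⟩ := hg.exists_countable hm hS
  have hins : (insert f₀ C).Countable := hC.insert f₀
  obtain ⟨e, he⟩ := hins.exists_eq_range (Set.insert_nonempty f₀ C)
  have heS : ∀ n, e n ∈ S := fun n => by
    have : e n ∈ insert f₀ C := by rw [he]; exact ⟨n, rfl⟩
    exact Set.insert_subset hf₀ hCS this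
  choose! j hjS hj1 hj2 using hdir
  -- Each new term dominates both its predecessor and the next member of the enumerated countable
  -- family.
  let F : ℕ → S := fun n => Nat.rec ⟨f₀, hf₀⟩
    (fun k p => ⟨j p.1 (e k), hjS _ p.2 _ (heS k)⟩) n
  have hF : ∀ n, ((F (n + 1) : S) : Ω → EReal) = j (F n).1 (e n) := fun n => rfl
  refine ⟨fun n => (F n).1, rfl, fun n => (F n).2, fun n => ?_, ?_⟩
  · simp only [hF]
    exact hj1 _ (F n).2 _ (heS n)
  · have h1 : ∀ᵐ ω ∂μ, ∀ n, (F n).1 ω ≤ g ω := ae_all_iff.2 fun n => hg.le _ (F n).2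
    have h2 : ∀ᵐ ω ∂μ, ∀ n, e n ω ≤ (F (n + 1)).1 ω :=
      ae_all_iff.2 fun n => by simp only [hF]; exact hj2 _ (F n).2 _ (heS n)
    filter_upwards [h1, h2, hgC] with ω h1 h2 h3
    refine le_antisymm (iSup_le h1) (h3.trans (iSup₂_le fun f hf => ?_))
    obtain ⟨n, rfl⟩ : f ∈ Set.range e := he ▸ Set.mem_insert_of_mem _ hf
    exact (h2 n).trans (le_iSup (fun n => (F n).1 ω) (n + 1))

/-! ### Monotone convergence for conditional expectations -/

/-- The conditional expectations increase, stay below that of the limit, and their integrals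
converge to its integral; this leaves no room for a smaller limit. -/
theorem tendsto_condExp_of_monotone {Ω : Type*} {m mΩ : MeasurableSpace Ω} (hm : m ≤ mΩ)
    {μ : Measure Ω} [IsFiniteMeasure μ] {f : ℕ → Ω → ℝ} {F : Ω → ℝ}
    (hf : ∀ n, Integrable (f n) μ) (hF : Integrable F μ)
    (hmono : ∀ᵐ ω ∂μ, Monotone fun n => f n ω)
    (hlim : ∀ᵐ ω ∂μ, Tendsto (fun n => f n ω) atTop (𝓝 (F ω))) :
    ∀ᵐ ω ∂μ, Tendsto (fun n => (μ[f n | m]) ω) atTop (𝓝 ((μ[F | m]) ω)) := by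
  refine tendsto_of_integral_tendsto_of_monotone (fun n => integrable_condExp)
    integrable_condExp ?_ ?_ ?_
  · simp_rw [integral_condExp hm]
    exact integral_tendsto_of_tendsto_of_monotone hf hF hmono hlim
  · have : ∀ᵐ ω ∂μ, ∀ n, (μ[f n | m]) ω ≤ (μ[f (n + 1) | m]) ω :=
      ae_all_iff.2 fun n => condExp_mono (hf n) (hf (n + 1))
        (hmono.mono fun ω h => h n.le_succ)
    filter_upwards [this] with ω h using monotone_nat_of_le_succ h
  · refine ae_all_iff.2 fun n => condExp_mono (hf n) hF ?_
    filter_upwards [hmono, hlim] with ω h1 h2 using h1.ge_of_tendsto h2 n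

/-! ### Riesz decomposition along a one-step recursion -/

section Riesz

variable {Ω : Type*} {mΩ : MeasurableSpace Ω} {ℱ : Filtration ℕ mΩ} {Q : Measure Ω}
  {V c : ℕ → Ω → ℝ}

/-- `V` and `c` are nonnegative adapted integrable processes with
`V_t = c_t + E[V_{t+1} | ℱ_t]`. -/
structure IsCostRecursion (ℱ : Filtration ℕ mΩ) (Q : Measure Ω) (V c : ℕ → Ω → ℝ) : Prop where
  adapted_value : ∀ t, StronglyMeasurable[ℱ t] (V t)
  adapted_cost : ∀ t, StronglyMeasurable[ℱ t] (c t)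
  integrable_value : ∀ t, Integrable (V t) Q
  integrable_cost : ∀ t, Integrable (c t) Q
  value_nonneg : ∀ t, 0 ≤ᵐ[Q] V t
  cost_nonneg : ∀ t, 0 ≤ᵐ[Q] c t
  recursion : ∀ t, V t =ᵐ[Q] c t + Q[V (t + 1) | ℱ t]

namespace IsCostRecursion

theorem integrable_sum (h : IsCostRecursion ℱ Q V c) (t : ℕ) :
    Integrable (fun ω => ∑ k ∈ Finset.range t, c k ω) Q :=
  integrable_finsetSum _ fun k _ => h.integrable_cost k

/-- The last summand has index `t - 1`, so the sum is already known at time `t - 1`. This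
predictability lets conditional expectations one step back leave it untouched. -/
theorem adapted_sum (h : IsCostRecursion ℱ Q V c) {t u : ℕ} (htu : t ≤ u + 1) :
    StronglyMeasurable[ℱ u] (fun ω => ∑ k ∈ Finset.range t, c k ω) :=
  Finset.stronglyMeasurable_fun_sum _ fun k hk =>
    (h.adapted_cost k).mono (ℱ.mono (by have := Finset.mem_range.1 hk; omega))

theorem ae_nonneg (h : IsCostRecursion ℱ Q V c) : ∀ᵐ ω ∂Q, ∀ k, 0 ≤ c k ω :=
  ae_all_iff.2 h.cost_nonneg

theorem tail_nonneg (h : IsCostRecursion ℱ Q V c) (t : ℕ) :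
    0 ≤ᵐ[Q] Q[fun ω => ∑' k, if t ≤ k then c k ω else 0 | ℱ t] := by
  refine condExp_nonneg ?_
  filter_upwards [h.ae_nonneg] with ω h1
  exact tsum_nonneg fun k => by split_ifs <;> simp [h1]

variable [IsFiniteMeasure Q]

theorem supermartingale (h : IsCostRecursion ℱ Q V c) : Supermartingale V ℱ Q := by
  refine supermartingale_nat h.adapted_value h.integrable_value fun t => ?_
  filter_upwards [h.recursion t, h.cost_nonneg t] with ω h1 h2
  rw [h1]
  simpa using h2

theorem martingale (h : IsCostRecursion ℱ Q V c) :
    Martingale (fun t ω => V t ω + ∑ k ∈ Finset.range t, c k ω) ℱ Q := by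
  refine martingale_nat (fun t => (h.adapted_value t).add (h.adapted_sum t.le_succ))
    (fun t => (h.integrable_value t).add (h.integrable_sum t)) fun t => ?_
  have h1 := condExp_add (h.integrable_value (t + 1)) (h.integrable_sum (t + 1)) (ℱ t)
  rw [condExp_of_stronglyMeasurable (ℱ.le t) (h.adapted_sum le_rfl) (h.integrable_sum _)] at h1
  filter_upwards [h1, h.recursion t] with ω h1 h2
  refine Eq.trans ?_ h1.symm
  simp only [Pi.add_apply] at h2 ⊢
  rw [h2, Finset.sum_range_succ]
  ring

/-- The martingale `V t + ∑_{k<t} c k` has constant mean, and dropping `V t ≥ 0` only decreases it.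
-/
theorem integral_sum_le (h : IsCostRecursion ℱ Q V c) (t : ℕ) :
    ∫ ω, ∑ k ∈ Finset.range t, c k ω ∂Q ≤ ∫ ω, V 0 ω ∂Q := by
  have h1 := h.martingale.setIntegral_eq (Nat.zero_le t) MeasurableSet.univ
  simp only [Finset.range_zero, Finset.sum_empty, add_zero, setIntegral_univ] at h1
  rw [h1]
  refine integral_mono_ae (h.integrable_sum t)
    ((h.integrable_value t).add (h.integrable_sum t)) ?_
  filter_upwards [h.value_nonneg t] with ω h2
  simpa using h2

/-- Stated in `ℝ≥0∞`, where the sum exists unconditionally. Almost sure summability and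
integrability of the real series are read off from it. -/
theorem lintegral_tsum_lt_top (h : IsCostRecursion ℱ Q V c) :
    ∫⁻ ω, ∑' k, ENNReal.ofReal (c k ω) ∂Q < ∞ := by
  have hm : ∀ k, AEMeasurable (fun ω => ENNReal.ofReal (c k ω)) Q := fun k =>
    (h.integrable_cost k).aemeasurable.ennreal_ofReal
  rw [lintegral_tsum hm]
  refine lt_of_le_of_lt (b := ENNReal.ofReal (∫ ω, V 0 ω ∂Q)) ?_ ENNReal.ofReal_lt_top
  rw [ENNReal.tsum_eq_iSup_nat]
  refine iSup_le fun t => ?_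
  rw [← lintegral_finsetSum' _ fun k _ => hm k]
  refine le_trans (le_of_eq ?_) (ENNReal.ofReal_le_ofReal (h.integral_sum_le t))
  rw [ofReal_integral_eq_lintegral_ofReal (h.integrable_sum t)]
  · refine lintegral_congr_ae ?_
    filter_upwards [h.ae_nonneg] with ω h1
    exact (ENNReal.ofReal_sum_of_nonneg fun k _ => h1 k).symm
  · filter_upwards [h.ae_nonneg] with ω h1
    exact Finset.sum_nonneg fun k _ => h1 k

theorem ae_summable (h : IsCostRecursion ℱ Q V c) : ∀ᵐ ω ∂Q, Summable fun k => c k ω := by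
  have hm : AEMeasurable (fun ω => ∑' k, ENNReal.ofReal (c k ω)) Q :=
    AEMeasurable.tsum fun k => (h.integrable_cost k).aemeasurable.ennreal_ofReal
  filter_upwards [ae_lt_top' hm h.lintegral_tsum_lt_top.ne, h.ae_nonneg] with ω h1 h2
  have := ENNReal.summable_toReal h1.ne
  simpa [ENNReal.toReal_ofReal (h2 _)] using this

theorem integrable_tsum (h : IsCostRecursion ℱ Q V c) :
    Integrable (fun ω => ∑' k, c k ω) Q := by
  have hm : AEMeasurable (fun ω => ∑' k, c k ω) Q :=
    AEMeasurable.tsum fun k => (h.integrable_cost k).aemeasurable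
  refine ⟨hm.aestronglyMeasurable, lt_of_le_of_lt (le_of_eq ?_) h.lintegral_tsum_lt_top⟩
  refine lintegral_congr_ae ?_
  filter_upwards [h.ae_nonneg, h.ae_summable] with ω h1 h2
  rw [Real.enorm_of_nonneg (tsum_nonneg h1), ENNReal.ofReal_tsum_of_nonneg h1 h2]

theorem tsum_tail_ae_eq (h : IsCostRecursion ℱ Q V c) (t : ℕ) :
    (fun ω => ∑' k, if t ≤ k then c k ω else 0) =ᵐ[Q]
      (fun ω => ∑' k, c k ω) - fun ω => ∑ k ∈ Finset.range t, c k ω := by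
  filter_upwards [h.ae_summable] with ω h1
  rw [Pi.sub_apply, eq_sub_iff_add_eq', ← h1.sum_add_tsum_nat_add t]
  congr 1
  have h2 : ∀ g : ℕ → ℝ, Summable g → (∀ k ∈ Finset.range t, g k = 0) →
      ∑' k, g k = ∑' k, g (k + t) := fun g hg h0 => by
    rw [← hg.sum_add_tsum_nat_add t, Finset.sum_eq_zero h0, zero_add]
  rw [h2]
  · exact tsum_congr fun k => if_pos (Nat.le_add_left t k)
  · have := h1.indicator {k | t ≤ k}
    refine this.congr fun k => ?_
    simp [Set.indicator]
  · intro k hk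
    exact if_neg (not_le.2 (Finset.mem_range.1 hk))

theorem condExp_tail_ae_eq (h : IsCostRecursion ℱ Q V c) (t : ℕ) :
    Q[fun ω => ∑' k, if t ≤ k then c k ω else 0 | ℱ t] =ᵐ[Q]
      Q[fun ω => ∑' k, c k ω | ℱ t] - fun ω => ∑ k ∈ Finset.range t, c k ω := by
  refine (condExp_congr_ae (h.tsum_tail_ae_eq t)).trans ?_
  have := condExp_sub h.integrable_tsum (h.integrable_sum t) (ℱ t)
  rwa [condExp_of_stronglyMeasurable (ℱ.le t) (h.adapted_sum t.le_succ)
    (h.integrable_sum _)] at this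

/-- The martingale part of the Riesz decomposition. -/
noncomputable def martingalePart (ℱ : Filtration ℕ mΩ) (Q : Measure Ω) (V c : ℕ → Ω → ℝ)
    (t : ℕ) : Ω → ℝ :=
  (fun ω => V t ω + ∑ k ∈ Finset.range t, c k ω) - Q[fun ω => ∑' k, c k ω | ℱ t]

theorem martingale_martingalePart (h : IsCostRecursion ℱ Q V c) :
    Martingale (martingalePart ℱ Q V c) ℱ Q :=
  h.martingale.sub (martingale_condExp _ ℱ Q)

/-- For `s ≥ t` the martingale property gives `E[V s | ℱ t] = M t - E[∑_{k<s} c k | ℱ t]`, and the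
subtracted term increases to `E[∑ c k | ℱ t]`. -/
theorem tendsto_martingalePart (h : IsCostRecursion ℱ Q V c) (t : ℕ) :
    ∀ᵐ ω ∂Q, Tendsto (fun s => (Q[V s | ℱ t]) ω) atTop (𝓝 (martingalePart ℱ Q V c t ω)) := by
  have h1 : ∀ᵐ ω ∂Q, ∀ s, t ≤ s → (Q[V s | ℱ t]) ω =
      (V t ω + ∑ k ∈ Finset.range t, c k ω)
        - (Q[fun ω => ∑ k ∈ Finset.range s, c k ω | ℱ t]) ω := by
    refine ae_all_iff.2 fun s => ?_
    by_cases hs : t ≤ s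
    · have h2 := condExp_add (h.integrable_value s) (h.integrable_sum s) (ℱ t)
      filter_upwards [h2, h.martingale.2 t s hs] with ω h2 h3 _
      rw [← h3, eq_sub_iff_add_eq]
      exact h2.symm
    · exact Eventually.of_forall fun ω h => absurd h hs
  have h2 := tendsto_condExp_of_monotone (ℱ.le t) h.integrable_sum h.integrable_tsum
    (h.ae_nonneg.mono fun ω hω => monotone_nat_of_le_succ fun n => by
      rw [Finset.sum_range_succ]; linarith [hω n])
    (h.ae_summable.mono fun ω hω => hω.hasSum.tendsto_sum_nat)
  filter_upwards [h1, h2] with ω h1 h2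
  refine (h2.const_sub _).congr' ?_
  filter_upwards [eventually_ge_atTop t] with s hs
  exact (h1 s hs).symm

theorem martingalePart_nonneg (h : IsCostRecursion ℱ Q V c) (t : ℕ) :
    0 ≤ᵐ[Q] martingalePart ℱ Q V c t := by
  have h1 : ∀ᵐ ω ∂Q, ∀ s, 0 ≤ (Q[V s | ℱ t]) ω :=
    ae_all_iff.2 fun s => condExp_nonneg (h.value_nonneg s)
  filter_upwards [h1, h.tendsto_martingalePart t] with ω h1 h2
  exact ge_of_tendsto' h2 h1

/-- By the tower property only the tails need comparing, and a later tail omits a nonnegative cost.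
-/
theorem supermartingale_tail (h : IsCostRecursion ℱ Q V c) :
    Supermartingale (fun t => Q[fun ω => ∑' k, if t ≤ k then c k ω else 0 | ℱ t]) ℱ Q := by
  refine supermartingale_nat (fun t => stronglyMeasurable_condExp)
    (fun t => integrable_condExp) fun t => ?_
  have hi : ∀ t, Integrable (fun ω => ∑' k, if t ≤ k then c k ω else 0) Q := fun t =>
    (h.integrable_tsum.sub (h.integrable_sum t)).congr (h.tsum_tail_ae_eq t).symm
  refine (condExp_condExp_of_le (ℱ.mono t.le_succ) (ℱ.le _)).le.trans
    (condExp_mono (hi _) (hi _) ?_)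
  filter_upwards [h.tsum_tail_ae_eq t, h.tsum_tail_ae_eq (t + 1), h.cost_nonneg t]
    with ω h1 h2 h3
  rw [h1, h2]
  simp only [Pi.sub_apply, Finset.sum_range_succ]
  simp only [Pi.zero_apply] at h3
  linarith

theorem tendsto_integral_tail (h : IsCostRecursion ℱ Q V c) :
    Tendsto (fun t => ∫ ω, (Q[fun ω => ∑' k, if t ≤ k then c k ω else 0 | ℱ t]) ω ∂Q)
      atTop (𝓝 0) := by
  have h1 := integral_tendsto_of_tendsto_of_monotone h.integrable_sum h.integrable_tsum
    (h.ae_nonneg.mono fun ω hω => monotone_nat_of_le_succ fun n => by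
      rw [Finset.sum_range_succ]; linarith [hω n])
    (h.ae_summable.mono fun ω hω => hω.hasSum.tendsto_sum_nat)
  have h2 := h1.const_sub (∫ ω, ∑' k, c k ω ∂Q)
  rw [sub_self] at h2
  refine h2.congr fun t => ?_
  rw [integral_condExp (ℱ.le t), integral_congr_ae (h.tsum_tail_ae_eq t)]
  exact (integral_sub h.integrable_tsum (h.integrable_sum t)).symm

theorem riesz_decomposition (h : IsCostRecursion ℱ Q V c) (t : ℕ) :
    V t =ᵐ[Q] Q[fun ω => ∑' k, if t ≤ k then c k ω else 0 | ℱ t] + martingalePart ℱ Q V c t := by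
  filter_upwards [h.condExp_tail_ae_eq t] with ω h1
  rw [Pi.add_apply, h1]
  simp only [martingalePart, Pi.sub_apply]
  ring

end IsCostRecursion

end Riesz

/-! ### Local absolute continuity -/

section LocAbsCont

variable {Ω : Type*} {mΩ : MeasurableSpace Ω} {ℱ : Filtration ℕ mΩ} {P Q : Measure Ω}

theorem measurable_densityProcess (n : ℕ) : Measurable[ℱ n] (densityProcess ℱ P Q n) :=
  Measure.measurable_rnDeriv _ _

/-- The event must belong to `ℱ t`: absolute continuity is available only on that `σ`-field. -/
theorem IsLocAbsCont.ae_of_ae {H : Horizon} (hQ : IsLocAbsCont H ℱ P Q) {t : ℕ}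
    (ht : (t : ℕ∞) ∈ H.times) {p : Ω → Prop} (hp : MeasurableSet[ℱ t] {ω | p ω})
    (h : ∀ᵐ ω ∂P, p ω) : ∀ᵐ ω ∂Q, p ω := by
  have h1 : P.trim (ℱ.le t) {ω | p ω}ᶜ = 0 := by
    rw [trim_measurableSet_eq _ hp.compl]; exact h
  have h2 := hQ t ht h1
  rw [trim_measurableSet_eq _ hp.compl] at h2
  exact h2

variable [IsFiniteMeasure P] [IsFiniteMeasure Q]

theorem measure_le_of_densityProcess_lt {n : ℕ} (h : Q.trim (ℱ.le n) ≪ P.trim (ℱ.le n))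
    {c : ℝ≥0∞} {s : Set Ω} (hs : MeasurableSet[ℱ n] s)
    (hc : ∀ ω ∈ s, densityProcess ℱ P Q n ω < c) : Q s ≤ c * P s := by
  rw [← trim_measurableSet_eq (ℱ.le n) hs, ← trim_measurableSet_eq (ℱ.le n) hs,
    ← Measure.setLIntegral_rnDeriv h s, ← setLIntegral_const]
  exact setLIntegral_mono' hs fun ω hω => (hc ω hω).le

/-- Maximal inequality for the reciprocal of the density process. -/
theorem measure_exists_densityProcess_lt_le
    (h : ∀ n, Q.trim (ℱ.le n) ≪ P.trim (ℱ.le n)) (c : ℝ≥0∞) {m : ℕ} {E : Set Ω}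
    (hE : MeasurableSet[ℱ m] E) :
    Q (E ∩ {ω | ∃ i, densityProcess ℱ P Q (m + i) ω < c}) ≤ c * P E := by
  let B : ℕ → Set Ω := fun i => E ∩ {ω | densityProcess ℱ P Q (m + i) ω < c}
  -- `B N \ U N` is the event that the density first drops below `c` at index `m + N`. These events
  -- are disjoint and known at that time, so the bound `Q ≤ c * P` on each can be summed.
  let U : ℕ → Set Ω := fun N => E ∩ {ω | ∃ i < N, densityProcess ℱ P Q (m + i) ω < c}
  have hB : ∀ i, MeasurableSet[ℱ (m + i)] (B i) := fun i =>
    (ℱ.mono (Nat.le_add_right m i) _ hE).inter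
      (measurable_densityProcess (m + i) measurableSet_Iio)
  have hUs : ∀ N, U (N + 1) = U N ∪ B N := by
    intro N
    ext ω
    simp only [U, B, Set.mem_inter_iff, Set.mem_union, Set.mem_ofPred_eq, Nat.lt_succ_iff_lt_or_eq,
      or_and_right, exists_or, exists_eq_left, and_or_left]
  have hU : ∀ N, MeasurableSet[ℱ (m + N)] (U N) := by
    intro N
    induction N with
    | zero => simp [U]
    | succ N ih =>
      rw [hUs]
      exact ℱ.mono (by omega) _ (ih.union (hB N))
  have hUm : ∀ N, MeasurableSet (U N) := fun N => ℱ.le _ _ (hU N)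
  have hQU : ∀ N, Q (U N) ≤ c * P (U N) := by
    intro N
    induction N with
    | zero => simp [U]
    | succ N ih =>
      have hd : MeasurableSet[ℱ (m + N)] (B N \ U N) := (hB N).diff (hU N)
      rw [hUs, ← Set.union_sdiff_self, measure_union Set.disjoint_sdiff_right (ℱ.le _ _ hd),
        measure_union Set.disjoint_sdiff_right (ℱ.le _ _ hd), mul_add]
      exact add_le_add ih (measure_le_of_densityProcess_lt (h _) hd fun ω hω => hω.1.2)
  have hmono : Monotone U := monotone_nat_of_le_succ fun N => by
    rw [hUs]; exact Set.subset_union_left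
  have heq : E ∩ {ω | ∃ i, densityProcess ℱ P Q (m + i) ω < c} = ⋃ N, U N := by
    ext ω
    simp only [U, Set.mem_inter_iff, Set.mem_ofPred_eq, Set.mem_iUnion, exists_and_left]
    refine and_congr_right fun _ => ⟨fun ⟨i, hi⟩ => ⟨i + 1, i, i.lt_succ_self, hi⟩,
      fun ⟨_, i, _, hi⟩ => ⟨i, hi⟩⟩
  rw [heq, hmono.measure_iUnion]
  exact iSup_le fun N => (hQU N).trans (by gcongr; exact Set.inter_subset_left)

/-- On `P`-null events of `ℱ_∞`, the density process tends to `∞` almost surely under `Q`. -/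
theorem ae_tendsto_densityProcess_of_null
    (h : ∀ n, Q.trim (ℱ.le n) ≪ P.trim (ℱ.le n)) {A : Set Ω}
    (hA : MeasurableSet[⨆ n, ℱ n] A) (hPA : P A = 0) :
    ∀ᵐ ω ∂Q, ω ∈ A → Tendsto (fun n => densityProcess ℱ P Q n ω) atTop (𝓝 ∞) := by
  have hle : (⨆ n, ℱ n) ≤ mΩ := iSup_le ℱ.le
  -- The density tends to `∞` exactly off the union of the sets `L c`, so it is enough that `A ∩ L
  -- c` is `Q`-null for each `c`.
  let L : ℕ → Set Ω := fun c => {ω | ∃ᶠ n in atTop, densityProcess ℱ P Q n ω < c}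
  have hL : ∀ (c m : ℕ) (E : Set Ω), MeasurableSet[ℱ m] E → Q (E ∩ L c) ≤ c * P E := by
    intro c m E hE
    refine le_trans (measure_mono ?_) (measure_exists_densityProcess_lt_le h c hE)
    rintro ω ⟨h1, h2⟩
    obtain ⟨n, hn, hn'⟩ := frequently_atTop.1 h2 m
    exact ⟨h1, n - m, by rwa [Nat.add_sub_cancel' hn]⟩
  have hring : IsSetRing (⋃ n, {t | MeasurableSet[ℱ n] t}) := by
    refine ⟨Set.mem_iUnion.2 ⟨0, @MeasurableSet.empty _ (ℱ 0)⟩, ?_, ?_⟩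
    · intro s t hs ht
      obtain ⟨i, hi⟩ := Set.mem_iUnion.1 hs
      obtain ⟨j, hj⟩ := Set.mem_iUnion.1 ht
      exact Set.mem_iUnion.2 ⟨max i j, MeasurableSet.union
        (ℱ.mono (le_max_left i j) _ hi) (ℱ.mono (le_max_right i j) _ hj)⟩
    · intro s t hs ht
      obtain ⟨i, hi⟩ := Set.mem_iUnion.1 hs
      obtain ⟨j, hj⟩ := Set.mem_iUnion.1 ht
      exact Set.mem_iUnion.2 ⟨max i j, MeasurableSet.diff
        (ℱ.mono (le_max_left i j) _ hi) (ℱ.mono (le_max_right i j) _ hj)⟩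
  have hnull : ∀ c : ℕ, Q (A ∩ L c) = 0 := by
    intro c
    refine le_antisymm (le_of_forall_pos_le_add fun ε hε => ?_) bot_le
    have hδ : 0 < ε / (c + 1) := ENNReal.div_pos hε.ne' (by finiteness)
    -- Approximate `A` by an event `t` of some `ℱ m`, simultaneously under `P` and `Q`. As `P A =
    -- 0`, `P t` is small, and the maximal inequality makes `Q (t ∩ L c)` small. The tolerance `ε /
    -- (c + 1)` is chosen so that `c` copies plus one more add up to `ε`.
    obtain ⟨t, ht, htA⟩ := @exists_measure_symmDiff_lt_of_generateFrom_isSetRing Ω (⨆ n, ℱ n)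
      ((P + Q).trim hle) _ _ hring
      ⟨{Set.univ}, Set.countable_singleton _,
        Set.singleton_subset_iff.2 (Set.mem_iUnion.2 ⟨0, MeasurableSet.univ⟩), by simp⟩
      (MeasurableSpace.generateFrom_iUnion_measurableSet fun n => ℱ n).symm A hA _ hδ
    obtain ⟨m, hm⟩ := Set.mem_iUnion.1 ht
    have htm : MeasurableSet[⨆ n, ℱ n] t := (le_iSup (fun n => ℱ n) m) _ hm
    rw [trim_measurableSet_eq hle (htm.symmDiff hA)] at htA
    have hPt : P t ≤ ε / (c + 1) := by
      calc P t ≤ P (symmDiff t A ∪ A) := measure_mono fun ω hω => by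
            by_cases hωA : ω ∈ A
            · exact Or.inr hωA
            · exact Or.inl (Or.inl ⟨hω, hωA⟩)
        _ ≤ P (symmDiff t A) + P A := measure_union_le _ _
        _ ≤ (P + Q) (symmDiff t A) := by
            rw [hPA, add_zero, Measure.add_apply]; exact le_self_add
        _ ≤ ε / (c + 1) := htA.le
    have hQt : Q (A \ t) ≤ ε / (c + 1) := by
      calc Q (A \ t) ≤ Q (symmDiff t A) := measure_mono fun ω hω => Or.inr hω
        _ ≤ (P + Q) (symmDiff t A) := by rw [Measure.add_apply]; exact le_add_self
        _ ≤ ε / (c + 1) := htA.le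
    calc Q (A ∩ L c) ≤ Q ((t ∩ L c) ∪ A \ t) := measure_mono fun ω hω => by
            by_cases hωt : ω ∈ t
            · exact Or.inl ⟨hωt, hω.2⟩
            · exact Or.inr ⟨hω.1, hωt⟩
      _ ≤ Q (t ∩ L c) + Q (A \ t) := measure_union_le _ _
      _ ≤ c * (ε / (c + 1)) + ε / (c + 1) :=
          add_le_add ((hL c m t hm).trans (by gcongr)) hQt
      _ = (c + 1) * (ε / (c + 1)) := by ring
      _ = ε := ENNReal.mul_div_cancel (by simp) (by finiteness)
      _ = 0 + ε := (zero_add ε).symm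
  have hall : ∀ᵐ ω ∂Q, ∀ c : ℕ, ω ∉ A ∩ L c :=
    ae_all_iff.2 fun c => measure_eq_zero_iff_ae_notMem.1 (hnull c)
  filter_upwards [hall] with ω hω hωA
  -- Level `c + 1` is used because leaving `L` yields only a non-strict lower bound, whereas
  -- strictly more than `c` is required.
  refine ENNReal.tendsto_nhds_top fun c => ?_
  have := hω (c + 1)
  have h2 : ¬ ∃ᶠ n in atTop, densityProcess ℱ P Q n ω < ((c + 1 : ℕ) : ℝ≥0∞) := fun h3 =>
    this ⟨hωA, h3⟩
  rw [not_frequently] at h2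
  filter_upwards [h2] with n hn
  exact lt_of_lt_of_le (by exact_mod_cast c.lt_succ_self) (not_lt.1 hn)

/-- `P`-almost sure properties at time `r` transfer to `{γ_r ≠ 0}` under `Q`. -/
theorem IsDiscounting.ae_of_ae {H : Horizon} {D : ℕ∞ → Ω → ℝ} (hD : IsDiscounting H ℱ P Q D)
    (hQ : IsLocAbsCont H ℱ P Q) {r : ℕ∞}
    (hr : r ∈ H.times) {p : Ω → Prop} (hp : MeasurableSet[sigmaAt ℱ r] {ω | p ω})
    (h : ∀ᵐ ω ∂P, p ω) : ∀ᵐ ω ∂Q, gammaOf H D r ω ≠ 0 → p ω := by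
  induction r using ENat.recTopCoe with
  | coe n =>
    rw [sigmaAt_coe] at hp
    filter_upwards [hQ.ae_of_ae hr hp h] with ω hω _ using hω
  -- At time infinity `γ_∞ = D_∞`, which is zero where the density explodes, and the exceptional
  -- event lies in that set up to a `Q`-null set.
  | top =>
    have hH : H = Horizon.natInfty := by
      cases H with
      | finite T => exact absurd hr (by simp [Horizon.times])
      | nat => exact absurd rfl hr
      | natInfty => rfl
    rw [sigmaAt_top] at hp
    have hQ' : ∀ n, Q.trim (ℱ.le n) ≪ P.trim (ℱ.le n) := fun n =>
      hQ n (by rw [hH]; exact Set.mem_univ _)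
    filter_upwards [ae_tendsto_densityProcess_of_null hQ' hp.compl h, hD.infty_eq_zero hH]
      with ω h1 h2 h3
    by_contra h4
    refine h3 ?_
    rw [gammaOf, if_pos (by rw [hH]; rfl)]
    exact h2 (h1 h4)

end LocAbsCont

/-! ### The measure `γ` on the time set -/

/-- `D` has a nonnegative non-increasing path with the correct behaviour at infinity. -/
structure IsRegularPath (H : Horizon) (d : ℕ∞ → ℝ) : Prop where
  nonneg : ∀ t ∈ H.times, 0 ≤ d t
  anti : ∀ n : ℕ, ((n + 1 : ℕ) : ℕ∞) ∈ H.times → d (n + 1 : ℕ) ≤ d n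
  tendsto_nat : H = Horizon.nat → Tendsto (fun n : ℕ => d n) atTop (𝓝 0)
  tendsto_infty : H = Horizon.natInfty → Tendsto (fun n : ℕ => d n) atTop (𝓝 (d ⊤))

theorem Horizon.countable_times (H : Horizon) : H.times.Countable := Set.to_countable _

theorem IsDiscounting.ae_isRegularPath {Ω : Type*} {mΩ : MeasurableSpace Ω}
    {ℱ : Filtration ℕ mΩ} {P Q : Measure Ω} {H : Horizon} {D : ℕ∞ → Ω → ℝ}
    (hD : IsDiscounting H ℱ P Q D) : ∀ᵐ ω ∂Q, IsRegularPath H (fun t => D t ω) := by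
  have h1 : ∀ᵐ ω ∂Q, ∀ t ∈ H.times, 0 ≤ D t ω :=
    (ae_ball_iff H.countable_times).2 fun t ht => hD.nonneg t ht
  have h2 : ∀ᵐ ω ∂Q, ∀ n : ℕ, ((n + 1 : ℕ) : ℕ∞) ∈ H.times → D (n + 1 : ℕ) ω ≤ D n ω := by
    refine ae_all_iff.2 fun n => ?_
    by_cases hn : ((n + 1 : ℕ) : ℕ∞) ∈ H.times
    · filter_upwards [hD.nonincreasing n hn] with ω hω _ using hω
    · exact Eventually.of_forall fun ω h => absurd h hn
  have h3 : ∀ᵐ ω ∂Q, H = Horizon.nat → Tendsto (fun n : ℕ => D n ω) atTop (𝓝 0) := by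
    by_cases hH : H = Horizon.nat
    · filter_upwards [hD.tendsto_nat hH] with ω hω _ using hω
    · exact Eventually.of_forall fun ω h => absurd h hH
  have h4 : ∀ᵐ ω ∂Q, H = Horizon.natInfty →
      Tendsto (fun n : ℕ => D n ω) atTop (𝓝 (D ⊤ ω)) := by
    by_cases hH : H = Horizon.natInfty
    · filter_upwards [hD.tendsto_infty hH] with ω hω _ using hω
    · exact Eventually.of_forall fun ω h => absurd h hH
  filter_upwards [h1, h2, h3, h4] with ω h1 h2 h3 h4 using ⟨h1, h2, h3, h4⟩

theorem Horizon.times_of_le {H : Horizon} {m n : ℕ} (h : (n : ℕ∞) ∈ H.times) (hmn : m ≤ n) :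
    (m : ℕ∞) ∈ H.times := by
  cases H with
  | finite T =>
    have h1 : (n : ℕ∞) ≤ T := h
    exact le_trans (Nat.cast_le.2 hmn) h1
  | nat => exact ENat.natCast_ne_top m
  | natInfty => exact Set.mem_univ _

theorem Horizon.lt_last_iff {H : Horizon} {n : ℕ} :
    (n : ℕ∞) < H.last ↔ ((n + 1 : ℕ) : ℕ∞) ∈ H.times := by
  cases H with
  | finite T =>
    simp only [Horizon.last, Horizon.times, Set.mem_ofPred_eq]
    norm_cast
  | nat => simp [Horizon.last, Horizon.times]
  | natInfty => simp [Horizon.last, Horizon.times]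

theorem Horizon.times_of_lt_last {H : Horizon} {n : ℕ} (h : (n : ℕ∞) < H.last) :
    (n : ℕ∞) ∈ H.times :=
  Horizon.times_of_le (Horizon.lt_last_iff.1 h) n.le_succ

theorem Horizon.le_last {H : Horizon} {s : ℕ∞} (h : s ∈ H.times) : s ≤ H.last := by
  cases H with
  | finite T => exact h
  | nat => exact le_top
  | natInfty => exact le_top

theorem Horizon.eq_last_or_lt {H : Horizon} {n : ℕ} (h : (n : ℕ∞) ∈ H.times) :
    (n : ℕ∞) = H.last ∨ (n : ℕ∞) < H.last :=
  (Horizon.le_last h).eq_or_lt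

theorem hasSum_enat {g : ℕ∞ → ℝ} {a : ℝ} (h : HasSum (fun n : ℕ => g n) a) :
    HasSum g (a + g ⊤) := by
  have h1 : HasSum (fun s : ℕ∞ => if s = ⊤ then 0 else g s) a := by
    refine (Function.Injective.hasSum_iff (g := ((↑) : ℕ → ℕ∞)) Nat.cast_injective ?_).1 ?_
    · intro s hs
      induction s using ENat.recTopCoe with
      | coe n => exact absurd ⟨n, rfl⟩ hs
      | top => simp
    · simpa [Function.comp_def] using h
  convert h1.add (hasSum_ite_eq (⊤ : ℕ∞) (g ⊤)) using 2 with s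
  split_ifs with hs <;> simp [hs]

section Gamma

variable {Ω : Type*} {H : Horizon} {D : ℕ∞ → Ω → ℝ} {ω : Ω}

theorem gammaOf_of_lt {n : ℕ} (h : (n : ℕ∞) < H.last) :
    gammaOf H D n ω = D n ω - D (n + 1 : ℕ) ω := by
  rw [gammaOf, if_neg h.ne]
  norm_cast

theorem gammaOf_of_eq {s : ℕ∞} (h : s = H.last) : gammaOf H D s ω = D s ω := by
  rw [gammaOf, if_pos h]

theorem IsRegularPath.gammaOf_nonneg (h : IsRegularPath H (fun t => D t ω)) {s : ℕ∞}
    (hs : s ∈ H.times) : 0 ≤ gammaOf H D s ω := by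
  rcases (Horizon.le_last hs).eq_or_lt with h1 | h1
  · rw [gammaOf_of_eq h1]; exact h.nonneg s hs
  · induction s using ENat.recTopCoe with
    | coe n =>
      rw [gammaOf_of_lt h1, sub_nonneg]
      exact h.anti n (Horizon.lt_last_iff.1 h1)
    | top => exact absurd h1 not_top_lt

/-- `∑_{s ∈ 𝕋_t} γ_s = D_t`. -/
theorem IsRegularPath.hasSum_gammaOf (h : IsRegularPath H (fun t => D t ω)) {t : ℕ}
    (ht : (t : ℕ∞) ∈ H.times) :
    HasSum (fun s : H.timesFrom t => gammaOf H D s ω) (D t ω) := by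
  classical
  set g : ℕ∞ → ℝ := (H.timesFrom t).indicator fun s => gammaOf H D s ω with hg
  have hg0 : ∀ s, 0 ≤ g s := fun s =>
    Set.indicator_nonneg (fun s hs => h.gammaOf_nonneg hs.1) s
  -- Extending by zero past the horizon encodes `D_{T+1} = 0`, so one telescoping formula serves all
  -- three time sets.
  let d : ℕ → ℝ := fun n => if (n : ℕ∞) ∈ H.times then D n ω else 0
  have hsum : ∀ k, ∑ n ∈ Finset.range (t + k), g n = D t ω - d (t + k) := by
    intro k
    induction k with
    | zero =>
      rw [Finset.sum_eq_zero fun n hn => ?_]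
      · simp [d, ht]
      · refine Set.indicator_of_notMem (fun hmem => ?_) _
        have h1 : t ≤ n := by exact_mod_cast hmem.2
        exact absurd (Finset.mem_range.1 hn) (by omega)
    | succ k ih =>
      rw [← add_assoc, Finset.sum_range_succ, ih]
      by_cases h1 : ((t + k : ℕ) : ℕ∞) ∈ H.times
      · have h2 : g ((t + k : ℕ) : ℕ∞) = gammaOf H D ((t + k : ℕ) : ℕ∞) ω :=
          Set.indicator_of_mem (s := H.timesFrom t)
            ⟨h1, by exact_mod_cast Nat.le_add_right t k⟩ _
        rw [h2]
        rcases Horizon.eq_last_or_lt h1 with h3 | h3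
        · have h4 : ((t + k + 1 : ℕ) : ℕ∞) ∉ H.times := by
            rw [← Horizon.lt_last_iff, h3]; exact lt_irrefl _
          simp only [d, if_pos h1, if_neg h4, gammaOf_of_eq h3]
          ring
        · simp only [d, if_pos h1, if_pos (Horizon.lt_last_iff.1 h3), gammaOf_of_lt h3]
          ring
      · have h2 : g ((t + k : ℕ) : ℕ∞) = 0 :=
          Set.indicator_of_notMem (fun hmem => h1 hmem.1) _
        have h3 : ((t + k + 1 : ℕ) : ℕ∞) ∉ H.times := fun h4 =>
          h1 (Horizon.times_of_le h4 (Nat.le_succ _))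
        simp only [d, if_neg h1, if_neg h3, h2, add_zero]
  -- What the finite times leave over is exactly the mass at `⊤`: zero for the first two time sets,
  -- `D_∞` for the third.
  have hlim : Tendsto d atTop (𝓝 (g ⊤)) := by
    cases H with
    | finite T =>
      have h1 : g ⊤ = 0 := Set.indicator_of_notMem
        (fun hmem => absurd (Horizon.le_last hmem.1) (by simp [Horizon.last])) _
      rw [h1]
      refine tendsto_const_nhds.congr' ?_
      filter_upwards [eventually_gt_atTop T] with n hn
      refine (if_neg fun h2 => ?_).symm
      have h3 : (n : ℕ∞) ≤ T := h2
      have h4 : n ≤ T := by exact_mod_cast h3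
      omega
    | nat =>
      have h1 : g ⊤ = 0 := Set.indicator_of_notMem (fun hmem => absurd rfl hmem.1) _
      rw [h1]
      refine (h.tendsto_nat rfl).congr fun n => ?_
      exact (if_pos (ENat.natCast_ne_top n)).symm
    | natInfty =>
      have h1 : g ⊤ = D ⊤ ω := by
        refine (Set.indicator_of_mem (s := Horizon.natInfty.timesFrom t)
          ⟨Set.mem_univ _, le_top⟩ _).trans (gammaOf_of_eq rfl)
      rw [h1]
      refine (h.tendsto_infty rfl).congr fun n => ?_
      exact (if_pos (Set.mem_univ _)).symm
  have hnat : HasSum (fun n : ℕ => g n) (D t ω - g ⊤) := by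
    rw [hasSum_iff_tendsto_nat_of_nonneg fun n => hg0 n]
    refine (hlim.const_sub _).congr' ?_
    filter_upwards [eventually_ge_atTop t] with n hn
    obtain ⟨k, rfl⟩ := Nat.exists_eq_add_of_le hn
    exact (hsum k).symm
  have := hasSum_enat hnat
  rw [sub_add_cancel] at this
  exact (hasSum_subtype_iff_indicator (f := fun s => gammaOf H D s ω)).2 this

end Gamma

/-! ### Pairing of processes with `γ` -/

/-- `∑_{s ∈ 𝕋_t} γ_s X_s`. -/
noncomputable def gammaSum {Ω : Type*} (H : Horizon) (D : ℕ∞ → Ω → ℝ) (t : ℕ)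
    (X : ℕ∞ → Ω → ℝ) (ω : Ω) : ℝ :=
  ∑' s : H.timesFrom t, gammaOf H D s ω * X s ω

theorem sigmaAt_le {Ω : Type*} {mΩ : MeasurableSpace Ω} (ℱ : Filtration ℕ mΩ) (t : ℕ∞) :
    sigmaAt ℱ t ≤ mΩ :=
  iSup₂_le fun n _ => ℱ.le n

theorem MemR.measurable_nat {Ω : Type*} {mΩ : MeasurableSpace Ω} {H : Horizon}
    {ℱ : Filtration ℕ mΩ} {P : Measure Ω} {X : ℕ∞ → Ω → ℝ} (hX : MemR H ℱ P X) {n : ℕ}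
    (hn : (n : ℕ∞) ∈ H.times) : Measurable[ℱ n] (X n) := by
  have := hX.1 n hn
  rwa [sigmaAt_coe] at this

section GammaSum

variable {Ω : Type*} {mΩ : MeasurableSpace Ω} {H : Horizon} {ℱ : Filtration ℕ mΩ}
  {P Q : Measure Ω} {D : ℕ∞ → Ω → ℝ} {X Y : ℕ∞ → Ω → ℝ} {t : ℕ}

theorem IsDiscounting.measurable_nat (hD : IsDiscounting H ℱ P Q D) {n : ℕ}
    (hn : (n : ℕ∞) ∈ H.times) : Measurable[ℱ n] (D n) := by
  cases n with
  | zero =>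
    have : D ((0 : ℕ) : ℕ∞) = fun _ => (1 : ℝ) := funext hD.zero
    rw [this]
    exact measurable_const
  | succ n => exact (hD.predictable n hn).mono (ℱ.mono n.le_succ) le_rfl

theorem IsDiscounting.measurable_gammaOf_nat (hD : IsDiscounting H ℱ P Q D) {n : ℕ}
    (hn : (n : ℕ∞) ∈ H.times) : Measurable[ℱ n] (gammaOf H D n) := by
  rcases Horizon.eq_last_or_lt hn with h | h
  · have : gammaOf H D n = D n := funext fun ω => gammaOf_of_eq h
    rw [this]
    exact hD.measurable_nat hn
  · have : gammaOf H D n = fun ω => D n ω - D (n + 1 : ℕ) ω := funext fun ω => gammaOf_of_lt h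
    rw [this]
    exact (hD.measurable_nat hn).sub (hD.predictable n (Horizon.lt_last_iff.1 h))

theorem IsDiscounting.measurable_gammaOf (hD : IsDiscounting H ℱ P Q D) {s : ℕ∞}
    (hs : s ∈ H.times) : Measurable (gammaOf H D s) := by
  induction s using ENat.recTopCoe with
  | coe n => exact (hD.measurable_gammaOf_nat hs).mono (ℱ.le n) le_rfl
  | top =>
    have h1 : (⊤ : ℕ∞) = H.last := (Horizon.le_last hs).antisymm le_top
    have : gammaOf H D ⊤ = D ⊤ := funext fun ω => gammaOf_of_eq h1
    rw [this]
    cases H with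
    | finite T => exact absurd h1 (by simp [Horizon.last])
    | nat => exact absurd rfl hs
    | natInfty => exact (hD.measurable_infty rfl).mono (sigmaAt_le ℱ ⊤) le_rfl

theorem measurable_gammaSum (hD : IsDiscounting H ℱ P Q D) (hX : MemR H ℱ P X) (t : ℕ) :
    Measurable (gammaSum H D t X) :=
  Measurable.tsum fun s : H.timesFrom t =>
    (hD.measurable_gammaOf s.2.1).mul ((hX.1 s s.2.1).mono (sigmaAt_le ℱ s) le_rfl)

theorem MemR.add (hX : MemR H ℱ P X) (hY : MemR H ℱ P Y) :
    MemR H ℱ P (fun s ω => X s ω + Y s ω) := by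
  obtain ⟨C, hC⟩ := hX.2
  obtain ⟨C', hC'⟩ := hY.2
  refine ⟨fun s hs => (hX.1 s hs).add (hY.1 s hs), C + C', ?_⟩
  filter_upwards [hC, hC'] with ω h1 h2 s hs
  exact (abs_add_le _ _).trans (add_le_add (h1 s hs) (h2 s hs))

theorem memR_zero : MemR H ℱ P fun _ _ => 0 :=
  ⟨fun _ _ => measurable_const, 0, by simp⟩

theorem gammaSum_zero : gammaSum H D t (fun _ _ => 0) = fun _ => 0 := by
  funext ω
  simp [gammaSum]

/-- With weights restricted to `0` and `1`, no summability is needed: one of the two series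
disappears. -/
theorem gammaSum_mixture (l : Ω → ℝ) (ω : Ω) (hl : l ω = 0 ∨ l ω = 1) :
    gammaSum H D t (fun s ω => l ω * X s ω + (1 - l ω) * Y s ω) ω =
      l ω * gammaSum H D t X ω + (1 - l ω) * gammaSum H D t Y ω := by
  rcases hl with h | h <;> simp [gammaSum, h]

variable [IsFiniteMeasure P] [IsFiniteMeasure Q]

/-- The bound on `X` passes from `P` to `Q` only where `γ_s ≠ 0`; after multiplication by `γ_s` it
holds everywhere. -/
theorem MemR.exists_ae_abs_le (hX : MemR H ℱ P X) (hD : IsDiscounting H ℱ P Q D)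
    (hQ : IsLocAbsCont H ℱ P Q) :
    ∃ C : ℝ, ∀ᵐ ω ∂Q, ∀ s ∈ H.times,
      |gammaOf H D s ω * X s ω| ≤ C * gammaOf H D s ω := by
  obtain ⟨C, hC⟩ := hX.2
  refine ⟨C, ?_⟩
  have h1 : ∀ᵐ ω ∂Q, ∀ s ∈ H.times, gammaOf H D s ω ≠ 0 → |X s ω| ≤ C := by
    refine (ae_ball_iff H.countable_times).2 fun s hs => ?_
    refine hD.ae_of_ae hQ hs (p := fun ω => |X s ω| ≤ C) ?_ (hC.mono fun ω h => h s hs)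
    exact measurable_abs.comp (hX.1 s hs) measurableSet_Iic
  filter_upwards [h1, hD.ae_isRegularPath] with ω h1 h2 s hs
  have h3 := h2.gammaOf_nonneg hs
  rw [abs_mul, abs_of_nonneg h3, mul_comm]
  rcases eq_or_ne (gammaOf H D s ω) 0 with h4 | h4
  · simp [h4]
  · exact mul_le_mul_of_nonneg_right (h1 s hs h4) h3

theorem MemR.ae_summable (hX : MemR H ℱ P X) (hD : IsDiscounting H ℱ P Q D)
    (hQ : IsLocAbsCont H ℱ P Q) (ht : (t : ℕ∞) ∈ H.times) :
    ∀ᵐ ω ∂Q, Summable fun s : H.timesFrom t => gammaOf H D s ω * X s ω := by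
  obtain ⟨C, hC⟩ := hX.exists_ae_abs_le hD hQ
  filter_upwards [hC, hD.ae_isRegularPath] with ω h1 h2
  exact Summable.of_norm_bounded ((h2.hasSum_gammaOf ht).summable.mul_left C)
    fun s => h1 s s.2.1

theorem MemR.exists_ae_abs_gammaSum_le (hX : MemR H ℱ P X) (hD : IsDiscounting H ℱ P Q D)
    (hQ : IsLocAbsCont H ℱ P Q) (ht : (t : ℕ∞) ∈ H.times) :
    ∃ C : ℝ, ∀ᵐ ω ∂Q, |gammaSum H D t X ω| ≤ C * D t ω := by
  obtain ⟨C, hC⟩ := hX.exists_ae_abs_le hD hQ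
  refine ⟨C, ?_⟩
  filter_upwards [hC, hD.ae_isRegularPath] with ω h1 h2
  exact tsum_of_norm_bounded (f := fun s : H.timesFrom t => gammaOf H D s ω * X s ω)
    ((h2.hasSum_gammaOf ht).mul_left C) fun s => h1 s s.2.1

theorem IsRegularPath.le_one (hD0 : ∀ ω, D 0 ω = 1) {ω : Ω}
    (h : IsRegularPath H (fun t => D t ω)) (ht : (t : ℕ∞) ∈ H.times) : D t ω ≤ 1 := by
  induction t with
  | zero => exact (hD0 ω).le
  | succ n ih => exact (h.anti n ht).trans (ih (Horizon.times_of_le ht n.le_succ))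

theorem MemR.integrable_gammaSum (hX : MemR H ℱ P X) (hD : IsDiscounting H ℱ P Q D)
    (hQ : IsLocAbsCont H ℱ P Q) (ht : (t : ℕ∞) ∈ H.times) :
    Integrable (gammaSum H D t X) Q := by
  obtain ⟨C, hC⟩ := hX.exists_ae_abs_gammaSum_le hD hQ ht
  refine Integrable.of_bound (measurable_gammaSum hD hX t).aestronglyMeasurable |C| ?_
  filter_upwards [hC, hD.ae_isRegularPath] with ω h1 h2
  refine h1.trans ((mul_le_mul_of_nonneg_right (le_abs_self C) (h2.nonneg t ht)).trans ?_)
  exact mul_le_of_le_one_right (abs_nonneg C) (h2.le_one hD.zero ht)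

theorem MemR.integrable_gammaSum_div (hX : MemR H ℱ P X) (hD : IsDiscounting H ℱ P Q D)
    (hQ : IsLocAbsCont H ℱ P Q) (ht : (t : ℕ∞) ∈ H.times) :
    Integrable (fun ω => gammaSum H D t X ω / D t ω) Q := by
  obtain ⟨C, hC⟩ := hX.exists_ae_abs_gammaSum_le hD hQ ht
  have hDm : Measurable (D t) := (hD.measurable_nat ht).mono (ℱ.le t) le_rfl
  refine Integrable.of_bound
    ((measurable_gammaSum hD hX t).div hDm).aestronglyMeasurable |C| ?_
  filter_upwards [hC, hD.ae_isRegularPath] with ω h1 h2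
  have h3 : 0 ≤ D t ω := h2.nonneg t ht
  rw [Real.norm_eq_abs, abs_div, abs_of_nonneg h3]
  refine div_le_of_le_mul₀ h3 (abs_nonneg C) (h1.trans ?_)
  exact mul_le_mul_of_nonneg_right (le_abs_self C) h3

theorem gammaSum_congr (hX : MemR H ℱ P X) (hY : MemR H ℱ P Y) (hD : IsDiscounting H ℱ P Q D)
    (hQ : IsLocAbsCont H ℱ P Q) (h : ∀ s ∈ H.timesFrom t, X s =ᵐ[P] Y s) :
    gammaSum H D t X =ᵐ[Q] gammaSum H D t Y := by
  have h1 : ∀ᵐ ω ∂Q, ∀ s ∈ H.timesFrom t, gammaOf H D s ω ≠ 0 → X s ω = Y s ω := by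
    refine (ae_ball_iff (Set.to_countable _)).2 fun s hs => ?_
    exact hD.ae_of_ae hQ hs.1 (p := fun ω => X s ω = Y s ω)
      (measurableSet_eq_fun (hX.1 s hs.1) (hY.1 s hs.1)) (h s hs)
  filter_upwards [h1] with ω h1
  refine tsum_congr fun s => ?_
  rcases eq_or_ne (gammaOf H D s ω) 0 with h4 | h4
  · simp [h4]
  · rw [h1 s s.2 h4]

theorem gammaSum_add (hX : MemR H ℱ P X) (hY : MemR H ℱ P Y) (hD : IsDiscounting H ℱ P Q D)
    (hQ : IsLocAbsCont H ℱ P Q) (ht : (t : ℕ∞) ∈ H.times) :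
    gammaSum H D t (fun s ω => X s ω + Y s ω) =ᵐ[Q]
      fun ω => gammaSum H D t X ω + gammaSum H D t Y ω := by
  filter_upwards [hX.ae_summable hD hQ ht, hY.ae_summable hD hQ ht] with ω h1 h2
  simp only [gammaSum]
  rw [← h1.tsum_add h2]
  exact tsum_congr fun s => mul_add _ _ _

theorem gammaSum_succ (hX : MemR H ℱ P X) (hD : IsDiscounting H ℱ P Q D)
    (hQ : IsLocAbsCont H ℱ P Q) (ht : (t : ℕ∞) < H.last) :
    gammaSum H D t X =ᵐ[Q]
      fun ω => gammaOf H D t ω * X t ω + gammaSum H D (t + 1) X ω := by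
  have ht' := Horizon.times_of_lt_last ht
  filter_upwards [hX.ae_summable hD hQ (Horizon.lt_last_iff.1 ht)] with ω h1
  set f : ℕ∞ → ℝ := fun s => gammaOf H D s ω * X s ω with hf
  have h2 := (hasSum_subtype_iff_indicator (f := f)).1 h1.hasSum
  have h3 : HasSum ((H.timesFrom t).indicator f)
      (∑' s : H.timesFrom (t + 1), f s + f t) := by
    convert h2.add (hasSum_ite_eq (t : ℕ∞) (f t)) using 2 with s
    by_cases hs : s = t
    · subst hs
      have h4 : (t : ℕ∞) ∉ H.timesFrom (t + 1) := fun h5 => by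
        have h6 : t + 1 ≤ t := by exact_mod_cast h5.2
        omega
      rw [Set.indicator_of_mem (s := H.timesFrom t) ⟨ht', le_rfl⟩,
        Set.indicator_of_notMem h4]
      simp
    · have h4 : s ∈ H.timesFrom t ↔ s ∈ H.timesFrom (t + 1) := by
        refine and_congr_right fun _ => ?_
        push_cast
        rw [ENat.add_one_le_iff (ENat.natCast_ne_top t)]
        exact ⟨fun h5 => lt_of_le_of_ne h5 (Ne.symm hs), le_of_lt⟩
      rw [if_neg hs, add_zero]
      by_cases h5 : s ∈ H.timesFrom t
      · rw [Set.indicator_of_mem h5, Set.indicator_of_mem (h4.1 h5)]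
      · rw [Set.indicator_of_notMem h5, Set.indicator_of_notMem (fun h6 => h5 (h4.2 h6))]
  have h4 := ((hasSum_subtype_iff_indicator (f := f)).2 h3).tsum_eq
  change ∑' s : H.timesFrom t, f s = f t + ∑' s : H.timesFrom (t + 1), f s
  rw [add_comm, ← h4]
  rfl

/-- From `t + 1` on the process is frozen at `X_{t+1}`, and `γ` has total mass `D_{t+1}` there. -/
theorem gammaSum_range (hX : MemRange H ℱ P t ((t + 1 : ℕ) : ℕ∞) X)
    (hD : IsDiscounting H ℱ P Q D) (hQ : IsLocAbsCont H ℱ P Q) (ht : (t : ℕ∞) < H.last) :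
    gammaSum H D (t + 1) X =ᵐ[Q] fun ω => D (t + 1 : ℕ) ω * X (t + 1 : ℕ) ω := by
  have ht1 := Horizon.lt_last_iff.1 ht
  have h1 : ∀ᵐ ω ∂Q, ∀ s ∈ H.timesFrom (t + 1),
      gammaOf H D s ω ≠ 0 → X s ω = X (t + 1 : ℕ) ω := by
    refine (ae_ball_iff (Set.to_countable _)).2 fun s hs => ?_
    have hle : sigmaAt ℱ ((t + 1 : ℕ) : ℕ∞) ≤ sigmaAt ℱ s :=
      iSup₂_le fun n hn => le_iSup₂_of_le n (hn.trans hs.2) le_rfl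
    refine hD.ae_of_ae hQ hs.1 (p := fun ω => X s ω = X (t + 1 : ℕ) ω)
      (measurableSet_eq_fun (hX.1.1 s hs.1) ((hX.1.1 _ ht1).mono hle le_rfl)) ?_
    filter_upwards [hX.2 s hs.1] with ω h
    have h2 : (t : ℕ∞) ≤ s := le_trans (by exact_mod_cast t.le_succ) hs.2
    rw [h, proj, if_pos h2, min_eq_right hs.2]
  filter_upwards [h1, hD.ae_isRegularPath] with ω h1 h2
  have h3 := (h2.hasSum_gammaOf ht1).mul_right (X (t + 1 : ℕ) ω)
  rw [← h3.tsum_eq]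
  refine tsum_congr fun s => ?_
  rcases eq_or_ne (gammaOf H D s ω) 0 with h4 | h4
  · simp [h4]
  · rw [h1 s s.2 h4]

end GammaSum

/-! ### Decomposition of acceptance sets -/

section Acceptance

variable {Ω : Type*} {mΩ : MeasurableSpace Ω} {H : Horizon} {ℱ : Filtration ℕ mΩ}
  {P : Measure Ω} {ρ : ℕ → (ℕ∞ → Ω → ℝ) → Ω → ℝ} {X Y Z : ℕ∞ → Ω → ℝ} {t : ℕ}

theorem MemRFrom.ae_eq_zero (hX : MemRFrom H ℱ P t X) {r : ℕ∞} (hr : r ∈ H.times)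
    (hrt : r < t) : X r =ᵐ[P] fun _ => 0 := by
  filter_upwards [hX.2 r hr] with ω h
  rw [h, proj, if_neg (not_le.2 hrt)]

theorem memRFrom_iff : MemRFrom H ℱ P t X ↔
    MemR H ℱ P X ∧ ∀ r ∈ H.times, r < t → X r =ᵐ[P] fun _ => 0 := by
  refine ⟨fun h => ⟨h.1, fun r hr hrt => h.ae_eq_zero hr hrt⟩, fun h => ⟨h.1, fun r hr => ?_⟩⟩
  rcases lt_or_ge r (t : ℕ∞) with h1 | h1
  · filter_upwards [h.2 r hr h1] with ω h2
    rw [h2, proj, if_neg (not_le.2 h1)]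
  · refine Eventually.of_forall fun ω => ?_
    rw [proj, if_pos h1, min_eq_left (Horizon.le_last hr)]

theorem memRFrom_zero : MemRFrom H ℱ P t fun _ _ => 0 :=
  memRFrom_iff.2 ⟨memR_zero, fun _ _ _ => ae_eq_refl _⟩

theorem MemRange.memRFrom {s : ℕ∞} (hX : MemRange H ℱ P t s X) : MemRFrom H ℱ P t X := by
  refine memRFrom_iff.2 ⟨hX.1, fun r hr hrt => ?_⟩
  filter_upwards [hX.2 r hr] with ω h
  rw [h, proj, if_neg (not_le.2 hrt)]

theorem MemRFrom.mono (hX : MemRFrom H ℱ P (t + 1) X) : MemRFrom H ℱ P t X :=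
  memRFrom_iff.2 ⟨hX.1, fun _ hr hrt =>
    hX.ae_eq_zero hr (hrt.trans (by exact_mod_cast t.lt_succ_self))⟩

theorem MemRFrom.add (hX : MemRFrom H ℱ P t X) (hY : MemRFrom H ℱ P t Y) :
    MemRFrom H ℱ P t (fun s ω => X s ω + Y s ω) := by
  refine memRFrom_iff.2 ⟨hX.1.add hY.1, fun r hr hrt => ?_⟩
  filter_upwards [hX.ae_eq_zero hr hrt, hY.ae_eq_zero hr hrt] with ω h1 h2
  simp [h1, h2]

theorem proj_last_apply_of_le {r : ℕ∞} (hr : r ∈ H.times) (h : (t : ℕ∞) ≤ r) :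
    proj t H.last X r = X r := by
  funext ω
  rw [proj, if_pos h, min_eq_left (Horizon.le_last hr)]

theorem proj_last_apply_of_lt {s r : ℕ∞} (h : r < (t : ℕ∞)) :
    proj t s X r = fun _ => 0 := by
  funext ω
  rw [proj, if_neg (not_le.2 h)]

theorem MemR.memRFrom_proj (hX : MemR H ℱ P X) : MemRFrom H ℱ P t (proj t H.last X) := by
  obtain ⟨C, hC⟩ := hX.2
  refine memRFrom_iff.2 ⟨⟨fun r hr => ?_, |C|, ?_⟩, fun r hr hrt => ?_⟩
  · rcases lt_or_ge r (t : ℕ∞) with h1 | h1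
    · rw [proj_last_apply_of_lt h1]; exact measurable_const
    · rw [proj_last_apply_of_le hr h1]; exact hX.1 r hr
  · filter_upwards [hC] with ω h r hr
    rcases lt_or_ge r (t : ℕ∞) with h1 | h1
    · rw [proj_last_apply_of_lt h1]; simp
    · rw [proj_last_apply_of_le hr h1]; exact (h r hr).trans (le_abs_self C)
  · rw [proj_last_apply_of_lt hrt]

/-- The constant process `c 1_{𝕋_t}`. -/
noncomputable def cashFrom (t : ℕ) (c : Ω → ℝ) : ℕ∞ → Ω → ℝ :=
  fun s ω => if (t : ℕ∞) ≤ s then c ω else 0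

theorem memRFrom_cashFrom {c : Ω → ℝ} (hc : MemLinfty (ℱ t) P c) :
    MemRFrom H ℱ P t (cashFrom t c) := by
  obtain ⟨hm, C, hC⟩ := hc
  refine memRFrom_iff.2 ⟨⟨fun r hr => ?_, |C|, ?_⟩, fun r hr hrt => ?_⟩
  · by_cases h : (t : ℕ∞) ≤ r
    · have h1 : cashFrom t c r = c := funext fun ω => if_pos h
      rw [h1]
      exact hm.mono (le_iSup₂_of_le t h le_rfl) le_rfl
    · have h1 : cashFrom t c r = fun _ => 0 := funext fun ω => if_neg h
      rw [h1]
      exact measurable_const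
  · filter_upwards [hC] with ω h r hr
    rw [cashFrom]
    split_ifs
    · exact h.trans (le_abs_self C)
    · simp
  · exact Eventually.of_forall fun ω => if_neg (not_le.2 hrt)

namespace IsCondConvexRiskMeasure

theorem congr (h : IsCondConvexRiskMeasure H ℱ P t (ρ t)) (hX : MemRFrom H ℱ P t X)
    (hY : MemRFrom H ℱ P t Y) (hXY : ∀ s ∈ H.timesFrom t, X s =ᵐ[P] Y s) :
    ρ t X =ᵐ[P] ρ t Y := by
  have h1 : ∀ s ∈ H.times, X s =ᵐ[P] Y s := fun s hs => by
    rcases lt_or_ge s (t : ℕ∞) with h2 | h2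
    · exact (hX.ae_eq_zero hs h2).trans (hY.ae_eq_zero hs h2).symm
    · exact hXY s ⟨hs, h2⟩
  exact (h.monotone Y X hY hX fun s hs => (h1 s hs).symm.le).antisymm
    (h.monotone X Y hX hY fun s hs => (h1 s hs).le)

theorem riskOf_ae_eq (h : IsCondConvexRiskMeasure H ℱ P t (ρ t)) (hX : MemRFrom H ℱ P t X) :
    riskOf H ρ t X =ᵐ[P] ρ t X :=
  h.congr hX.1.memRFrom_proj hX fun s hs => by rw [proj_last_apply_of_le hs.1 hs.2]

/-- The risk of a process that equals `Z` plus a constant from time `t` on. -/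
theorem riskOf_of_eq_add (h : IsCondConvexRiskMeasure H ℱ P t (ρ t)) (hX : MemR H ℱ P X)
    (hZ : MemRFrom H ℱ P t Z) {c : Ω → ℝ} (hc : MemLinfty (ℱ t) P c)
    (hXZ : ∀ s ∈ H.timesFrom t, X s =ᵐ[P] fun ω => Z s ω + c ω) :
    riskOf H ρ t X =ᵐ[P] fun ω => ρ t Z ω - c ω := by
  refine EventuallyEq.trans ?_ (h.cash_invariance Z hZ c hc)
  refine h.congr hX.memRFrom_proj (hZ.add (memRFrom_cashFrom hc)) fun s hs => ?_
  rw [proj_last_apply_of_le hs.1 hs.2]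
  filter_upwards [hXZ s hs] with ω h1
  rw [h1, if_pos hs.2]

end IsCondConvexRiskMeasure

theorem MemR.memLinfty (hX : MemR H ℱ P X) (ht : (t : ℕ∞) ∈ H.times) :
    MemLinfty (ℱ t) P (X t) := by
  obtain ⟨C, hC⟩ := hX.2
  exact ⟨hX.measurable_nat ht, C, hC.mono fun ω h => h t ht⟩

theorem zero_mem_acceptanceSet (h : IsCondConvexRiskMeasure H ℱ P t (ρ t)) :
    (fun _ _ => 0) ∈ acceptanceSet H ℱ P ρ t :=
  ⟨memRFrom_zero, by filter_upwards [h.normalized] with ω h1 using h1.le⟩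

theorem zero_mem_acceptanceSetOneStep (h : IsCondConvexRiskMeasure H ℱ P t (ρ t)) :
    (fun _ _ => 0) ∈ acceptanceSetOneStep H ℱ P ρ t :=
  ⟨⟨memR_zero, fun r _ => Eventually.of_forall fun ω => by simp [proj]⟩,
    by filter_upwards [h.normalized] with ω h1 using h1.le⟩

theorem mixture_mem_acceptanceSet (h : IsCondConvexRiskMeasure H ℱ P t (ρ t))
    (hX : X ∈ acceptanceSet H ℱ P ρ t) (hY : Y ∈ acceptanceSet H ℱ P ρ t) {l : Ω → ℝ}
    (hl : Measurable[ℱ t] l) (hl01 : ∀ ω, 0 ≤ l ω ∧ l ω ≤ 1) :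
    MemR H ℱ P (fun s ω => l ω * X s ω + (1 - l ω) * Y s ω) →
    (fun s ω => l ω * X s ω + (1 - l ω) * Y s ω) ∈ acceptanceSet H ℱ P ρ t := by
  refine fun hmem => ⟨memRFrom_iff.2 ⟨hmem, fun r hr hrt => ?_⟩, ?_⟩
  · filter_upwards [hX.1.ae_eq_zero hr hrt, hY.1.ae_eq_zero hr hrt] with ω h1 h2
    simp [h1, h2]
  · have hl' : MemLinfty (ℱ t) P l :=
      ⟨hl, 1, Eventually.of_forall fun ω => abs_le.2 ⟨by linarith [(hl01 ω).1], (hl01 ω).2⟩⟩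
    filter_upwards [h.convex X Y hX.1 hY.1 l hl' (Eventually.of_forall hl01), hX.2, hY.2]
      with ω h1 h2 h3
    have h4 := mul_nonpos_of_nonneg_of_nonpos (hl01 ω).1 h2
    have h5 := mul_nonpos_of_nonneg_of_nonpos (sub_nonneg.2 (hl01 ω).2) h3
    linarith

variable (hρ : IsDynConvexRiskMeasure H ℱ P ρ) (htc : IsTimeConsistent H ℱ P ρ)
  (ht : (t : ℕ∞) < H.last)

include hρ htc ht

/-- `𝒜_{t,t+1} + 𝒜_{t+1} ⊆ 𝒜_t`. -/
theorem add_mem_acceptanceSet (hY : Y ∈ acceptanceSetOneStep H ℱ P ρ t)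
    (hZ : Z ∈ acceptanceSet H ℱ P ρ (t + 1)) :
    (fun s ω => Y s ω + Z s ω) ∈ acceptanceSet H ℱ P ρ t := by
  have ht0 := Horizon.times_of_lt_last ht
  have ht1 := Horizon.lt_last_iff.1 ht
  have hYF := hY.1.memRFrom
  have hX := hYF.add hZ.1.mono
  have hYc : ∀ s ∈ H.timesFrom (t + 1), Y s =ᵐ[P] Y (t + 1 : ℕ) := fun s hs => by
    filter_upwards [hY.1.2 s hs.1] with ω h
    have h2 : (t : ℕ∞) ≤ s := le_trans (by exact_mod_cast t.le_succ) hs.2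
    rw [h, proj, if_pos h2, min_eq_right hs.2]
  have hc : MemLinfty (ℱ (t + 1)) P (Y (t + 1 : ℕ)) := hY.1.1.memLinfty ht1
  have h1 := (hρ _ ht1).riskOf_of_eq_add hX.1 hZ.1 hc fun s hs => by
    filter_upwards [hYc s hs] with ω h
    rw [h, add_comm]
  have h2 := (hρ _ ht1).riskOf_of_eq_add (X := Y) hY.1.1 memRFrom_zero hc fun s hs => by
    filter_upwards [hYc s hs] with ω h
    rw [h, zero_add]
  -- From `t + 1` on, `Y` is the cash amount `Y_{t+1}`, so `ρ_{t+1}(Y + Z) = ρ_{t+1}(Z) - Y_{t+1} ≤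
  -- -Y_{t+1} = ρ_{t+1}(Y)`. Also `Z_t = 0`, so time consistency applies.
  have h3 : riskOf H ρ t (fun s ω => Y s ω + Z s ω) ≤ᵐ[P] riskOf H ρ t Y := by
    refine htc t ht _ _ hX.1 hY.1.1 ?_ ?_
    · filter_upwards [hZ.1.ae_eq_zero ht0 (by exact_mod_cast t.lt_succ_self)] with ω h
      simp [h]
    · filter_upwards [h1, h2, hZ.2, (hρ _ ht1).normalized] with ω h1 h2 h3 h4
      rw [h1, h2, h4]
      linarith
  refine ⟨hX, ?_⟩
  filter_upwards [h3, (hρ t ht0).riskOf_ae_eq hX, (hρ t ht0).riskOf_ae_eq hYF, hY.2]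
    with ω h4 h5 h6 h7
  rw [← h5]
  exact h4.trans (h6.le.trans h7)

/-- `𝒜_t ⊆ 𝒜_{t,t+1} + 𝒜_{t+1}`. -/
theorem exists_add_of_mem_acceptanceSet (hX : X ∈ acceptanceSet H ℱ P ρ t) :
    ∃ Y ∈ acceptanceSetOneStep H ℱ P ρ t, ∃ Z ∈ acceptanceSet H ℱ P ρ (t + 1),
      ∀ s ∈ H.timesFrom t, X s =ᵐ[P] fun ω => Y s ω + Z s ω := by
  have ht0 := Horizon.times_of_lt_last ht
  have ht1 := Horizon.lt_last_iff.1 ht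
  have hXR := hX.1.1
  set R : Ω → ℝ := riskOf H ρ (t + 1) X with hR
  have hRL : MemLinfty (ℱ (t + 1)) P R := (hρ _ ht1).memLinfty _ hXR.memRFrom_proj
  have hRL' : MemLinfty (ℱ (t + 1)) P (fun ω => -R ω) := by
    obtain ⟨h1, C, h2⟩ := hRL
    exact ⟨h1.neg, C, by simpa only [abs_neg] using h2⟩
  have hcash := memRFrom_cashFrom (H := H) hRL'
  -- Keep `X_t` and replace the future by its certainty equivalent `-ρ_{t+1}(X)`. Then `ρ_{t+1}(Y) =
  -- ρ_{t+1}(X)`, and time consistency makes `Y` acceptable.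
  let Y : ℕ∞ → Ω → ℝ := fun s ω => if s = t then X t ω else cashFrom (t + 1) (fun ω => -R ω) s ω
  have hlt : (t : ℕ∞) < ((t + 1 : ℕ) : ℕ∞) := by exact_mod_cast t.lt_succ_self
  have hYt : Y t = X t := funext fun ω => if_pos rfl
  have hYne : ∀ s : ℕ∞, s ≠ t → Y s = cashFrom (t + 1) (fun ω => -R ω) s := fun s hs =>
    funext fun ω => if_neg hs
  have hYge : ∀ s : ℕ∞, ((t + 1 : ℕ) : ℕ∞) ≤ s → Y s = fun ω => -R ω := fun s hs => by
    rw [hYne s (hlt.trans_le hs).ne']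
    exact funext fun ω => if_pos hs
  have hYR : MemR H ℱ P Y := by
    obtain ⟨C, hC⟩ := hXR.2
    obtain ⟨C', hC'⟩ := hcash.1.2
    refine ⟨fun s hs => ?_, max C C', ?_⟩
    · by_cases h : s = t
      · subst h; rw [hYt]; exact hXR.1 _ hs
      · rw [hYne s h]; exact hcash.1.1 s hs
    · filter_upwards [hC, hC'] with ω h1 h2 s hs
      by_cases h : s = t
      · subst h; rw [hYt]; exact (h1 _ hs).trans (le_max_left _ _)
      · rw [hYne s h]; exact (h2 s hs).trans (le_max_right _ _)
  have hYrange : MemRange H ℱ P t ((t + 1 : ℕ) : ℕ∞) Y := by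
    refine ⟨hYR, fun r hr => Eventually.of_forall fun ω => ?_⟩
    rw [proj]
    split_ifs with h
    · rcases h.eq_or_lt with h1 | h1
      · rw [← h1, min_eq_left hlt.le]
      · have h2 : ((t + 1 : ℕ) : ℕ∞) ≤ r := by
          push_cast
          exact (ENat.add_one_le_iff (ENat.natCast_ne_top t)).2 h1
        rw [min_eq_right h2, hYge r h2, hYge _ le_rfl]
    · rw [hYne r fun h1 => h h1.ge]
      exact if_neg fun h1 => h (hlt.le.trans h1)
  -- The remaining future, shifted by `ρ_{t+1}(X)`, has risk zero by cash invariance.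
  let Z : ℕ∞ → Ω → ℝ := fun s ω => proj (t + 1) H.last X s ω + cashFrom (t + 1) R s ω
  have hZF : MemRFrom H ℱ P (t + 1) Z :=
    hXR.memRFrom_proj.add (memRFrom_cashFrom hRL)
  have hZ : Z ∈ acceptanceSet H ℱ P ρ (t + 1) := by
    refine ⟨hZF, ?_⟩
    filter_upwards [(hρ _ ht1).cash_invariance _ hXR.memRFrom_proj R hRL] with ω h1
    exact (h1.trans (sub_self _)).le
  have hYacc : Y ∈ acceptanceSetOneStep H ℱ P ρ t := by
    refine ⟨hYrange, ?_⟩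
    have h1 := (hρ _ ht1).riskOf_of_eq_add hYR memRFrom_zero hRL' fun s hs => by
      rw [hYge s hs.2]
      simp
    have h2 : riskOf H ρ t Y ≤ᵐ[P] riskOf H ρ t X := by
      refine htc t ht _ _ hYR hXR hYt.eventuallyEq ?_
      filter_upwards [h1, (hρ _ ht1).normalized] with ω h1 h2
      rw [h1, h2]
      simp [hR]
    filter_upwards [h2, (hρ t ht0).riskOf_ae_eq hX.1,
      (hρ t ht0).riskOf_ae_eq hYrange.memRFrom, hX.2] with ω h4 h5 h6 h7
    rw [← h6]
    exact h4.trans (h5.le.trans h7)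
  refine ⟨Y, hYacc, Z, hZ, fun s hs => Eventually.of_forall fun ω => ?_⟩
  rcases hs.2.eq_or_lt with h1 | h1
  · rw [← h1, hYt]
    simp only [Z]
    rw [proj_last_apply_of_lt hlt, cashFrom, if_neg (not_le.2 hlt)]
    simp
  · have h2 : ((t + 1 : ℕ) : ℕ∞) ≤ s := by
      push_cast
      exact (ENat.add_one_le_iff (ENat.natCast_ne_top t)).2 h1
    rw [hYge s h2]
    simp only [Z]
    rw [proj_last_apply_of_le hs.1 h2, cashFrom, if_pos h2]
    ring

end Acceptance

/-! ### Discounted penalties as essential suprema -/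

namespace IsEssSupFamily

variable {Ω ι : Type*} {m mΩ : MeasurableSpace Ω} {μ : Measure Ω}

theorem congr_family {A : Set ι} {z z' : ι → Ω → EReal} {g : Ω → EReal}
    (h : IsEssSupFamily m μ (z '' A) g) (hz : ∀ i ∈ A, z i =ᵐ[μ] z' i) :
    IsEssSupFamily m μ (z' '' A) g := by
  refine ⟨h.measurable, ?_, fun h' hm' hle => h.least h' hm' ?_⟩
  · rintro _ ⟨i, hi, rfl⟩
    exact (hz i hi).symm.le.trans (h.le _ ⟨i, hi, rfl⟩)
  · rintro _ ⟨i, hi, rfl⟩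
    exact (hz i hi).le.trans (hle _ ⟨i, hi, rfl⟩)

/-- Multiplying an essential supremum by a nonnegative random variable `d`, with the
product read as `0` on `{d = 0}`. -/
theorem mul_real {A : Set ι} (hA : A.Nonempty) {z g : ι → Ω → ℝ} {U W : Ω → EReal} {d : Ω → ℝ}
    (hd : Measurable d) (hd0 : 0 ≤ᵐ[μ] d)
    (hU : IsEssSupFamily m μ ((fun i ω => (g i ω : EReal)) '' A) U)
    (hz : ∀ i ∈ A, ∀ᵐ ω ∂μ, z i ω = d ω * g i ω) (hW : Measurable[m] W)
    (hWpos : ∀ ω, 0 < d ω → W ω = d ω * U ω) (hWzero : ∀ ω, d ω = 0 → W ω = 0) :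
    IsEssSupFamily m μ ((fun i ω => (z i ω : EReal)) '' A) W := by
  refine ⟨hW, ?_, fun h hm hle => ?_⟩
  · rintro _ ⟨i, hi, rfl⟩
    filter_upwards [hU.le _ ⟨i, hi, rfl⟩, hz i hi, hd0] with ω h1 h2 h3
    rcases (show 0 ≤ d ω from h3).eq_or_lt with h4 | h4
    · rw [hWzero ω h4.symm, h2, ← h4]
      simp
    · rw [hWpos ω h4, h2, EReal.coe_mul]
      exact mul_le_mul_of_nonneg_left h1 (EReal.coe_nonneg.2 h4.le)
  · obtain ⟨i₀, hi₀⟩ := hA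
    classical
    -- Dividing an upper bound of the scaled family by `d` bounds the unscaled one on `{d > 0}`;
    -- elsewhere `⊤` imposes nothing.
    have h1 : U ≤ᵐ[μ] fun ω => if 0 < d ω then (((d ω)⁻¹ : ℝ) : EReal) * h ω else ⊤ := by
      refine hU.least _ ?_ ?_
      · exact Measurable.ite (measurableSet_lt measurable_const hd)
          (hd.inv.coe_real_ereal.mul hm) measurable_const
      · rintro _ ⟨i, hi, rfl⟩
        filter_upwards [hle _ ⟨i, hi, rfl⟩, hz i hi] with ω h1 h2
        split_ifs with h3
        · have h4 : g i ω = (d ω)⁻¹ * z i ω := by rw [h2, inv_mul_cancel_left₀ h3.ne']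
          rw [h4, EReal.coe_mul]
          exact mul_le_mul_of_nonneg_left h1 (EReal.coe_nonneg.2 (inv_pos.2 h3).le)
        · exact le_top
    filter_upwards [h1, hle _ ⟨i₀, hi₀, rfl⟩, hz i₀ hi₀, hd0] with ω h1 h2 h3 h4
    rcases (show 0 ≤ d ω from h4).eq_or_lt with h5 | h5
    · rw [hWzero ω h5.symm]
      rw [h3, ← h5] at h2
      simpa using h2
    · rw [if_pos h5] at h1
      rw [hWpos ω h5]
      calc (d ω : EReal) * U ω ≤ d ω * (((d ω)⁻¹ : ℝ) * h ω) :=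
            mul_le_mul_of_nonneg_left h1 (EReal.coe_nonneg.2 h5.le)
        _ = h ω := by
            rw [← mul_assoc, ← EReal.coe_mul, mul_inv_cancel₀ h5.ne', EReal.coe_one, one_mul]

/-- On `{d = 0}` every member vanishes and the family is nonempty, so the essential supremum is `0`,
in agreement with the convention `0 · ∞ = 0`. -/
theorem congr_of_ne_zero {A : Set ι} (hA : A.Nonempty) {z : ι → Ω → ℝ} {U W : Ω → EReal}
    {d : Ω → ℝ} (hd0 : 0 ≤ᵐ[μ] d)
    (hU : IsEssSupFamily m μ ((fun i ω => (z i ω : EReal)) '' A) U)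
    (hz : ∀ i ∈ A, ∀ᵐ ω ∂μ, d ω = 0 → z i ω = 0) (hW : Measurable[m] W)
    (hWpos : ∀ ω, 0 < d ω → W ω = U ω) (hWzero : ∀ ω, d ω = 0 → W ω = 0) :
    IsEssSupFamily m μ ((fun i ω => (z i ω : EReal)) '' A) W := by
  refine ⟨hW, ?_, fun h hm hle => ?_⟩
  · rintro _ ⟨i, hi, rfl⟩
    filter_upwards [hU.le _ ⟨i, hi, rfl⟩, hz i hi, hd0] with ω h1 h2 h3
    rcases (show 0 ≤ d ω from h3).eq_or_lt with h4 | h4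
    · rw [hWzero ω h4.symm, h2 h4.symm]
      simp
    · rwa [hWpos ω h4]
  · obtain ⟨i₀, hi₀⟩ := hA
    filter_upwards [hU.least h hm hle, hle _ ⟨i₀, hi₀, rfl⟩, hz i₀ hi₀, hd0] with ω h1 h2 h3 h4
    rcases (show 0 ≤ d ω from h4).eq_or_lt with h5 | h5
    · rw [hWzero ω h5.symm]
      rw [h3 h5.symm] at h2
      simpa using h2
    · rwa [hWpos ω h5]

end IsEssSupFamily

/-- Monotone convergence for an increasing sequence of random variables whose supremum is
only known to be extended real valued. -/
theorem ae_lt_top_of_monotone_of_integral_le {Ω : Type*} {mΩ : MeasurableSpace Ω}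
    {μ : Measure Ω} {f : ℕ → Ω → ℝ} {V : Ω → EReal} {K : ℝ}
    (hf : ∀ n, Integrable (f n) μ) (hmono : ∀ᵐ ω ∂μ, Monotone fun n => f n ω)
    (h0 : 0 ≤ᵐ[μ] f 0) (hV : ∀ᵐ ω ∂μ, ⨆ n, (f n ω : EReal) = V ω)
    (hK : ∀ n, ∫ ω, f n ω ∂μ ≤ K) :
    (∀ᵐ ω ∂μ, V ω < ⊤) ∧ Integrable (fun ω => (V ω).toReal) μ ∧
      ∀ᵐ ω ∂μ, Tendsto (fun n => f n ω) atTop (𝓝 (V ω).toReal) := by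
  have hm : ∀ n, AEMeasurable (fun ω => ENNReal.ofReal (f n ω)) μ := fun n =>
    (hf n).aemeasurable.ennreal_ofReal
  have hnn : ∀ᵐ ω ∂μ, ∀ n, 0 ≤ f n ω := by
    filter_upwards [hmono, h0] with ω h1 h2 n using le_trans h2 (h1 n.zero_le)
  have hint : ∫⁻ ω, ⨆ n, ENNReal.ofReal (f n ω) ∂μ < ∞ := by
    rw [lintegral_iSup' hm
      (hmono.mono fun ω h i j hij => ENNReal.ofReal_le_ofReal (h hij))]
    refine lt_of_le_of_lt (iSup_le fun n => ?_) (ENNReal.ofReal_lt_top (r := K))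
    rw [← ofReal_integral_eq_lintegral_ofReal (hf n) (hnn.mono fun ω h => h n)]
    exact ENNReal.ofReal_le_ofReal (hK n)
  -- The bounded integrals make the `ℝ≥0∞` supremum finite; its real value then dominates the
  -- sequence, and later serves as the integrable bound for `V`.
  have hbdd : ∀ᵐ ω ∂μ, ∀ n, f n ω ≤ (⨆ n, ENNReal.ofReal (f n ω)).toReal := by
    filter_upwards [ae_lt_top' (AEMeasurable.iSup hm) hint.ne] with ω h1 n
    exact (ENNReal.ofReal_le_iff_le_toReal h1.ne).1
      (le_iSup (fun n => ENNReal.ofReal (f n ω)) n)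
  have hfin : ∀ᵐ ω ∂μ, V ω < ⊤ ∧ ((V ω).toReal : EReal) = V ω ∧ 0 ≤ (V ω).toReal ∧
      (V ω).toReal ≤ (⨆ n, ENNReal.ofReal (f n ω)).toReal := by
    filter_upwards [hbdd, hV, hnn] with ω h1 h2 h3
    have h4 : V ω ≤ ((⨆ n, ENNReal.ofReal (f n ω)).toReal : EReal) := by
      rw [← h2]
      exact iSup_le fun n => EReal.coe_le_coe_iff.2 (h1 n)
    have h5 : 0 ≤ V ω := by
      rw [← h2]
      exact le_trans (EReal.coe_nonneg.2 (h3 0)) (le_iSup (fun n => (f n ω : EReal)) 0)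
    have h6 : V ω < ⊤ := lt_of_le_of_lt h4 (EReal.coe_lt_top _)
    have h7 : ((V ω).toReal : EReal) = V ω :=
      EReal.coe_toReal h6.ne (lt_of_lt_of_le (EReal.bot_lt_coe 0) h5).ne'
    exact ⟨h6, h7, EReal.toReal_nonneg h5, EReal.coe_le_coe_iff.1 (h7.le.trans h4)⟩
  have htend : ∀ᵐ ω ∂μ, Tendsto (fun n => f n ω) atTop (𝓝 (V ω).toReal) := by
    filter_upwards [hfin, hmono, hV] with ω h1 h2 h3
    rw [← EReal.tendsto_coe, h1.2.1, ← h3]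
    exact tendsto_atTop_iSup fun i j hij => EReal.coe_le_coe_iff.2 (h2 hij)
  refine ⟨hfin.mono fun ω h => h.1, ⟨aestronglyMeasurable_of_tendsto_ae atTop
    (fun n => (hf n).aestronglyMeasurable) htend, lt_of_le_of_lt ?_ hint⟩, htend⟩
  refine lintegral_mono_ae ?_
  filter_upwards [hfin] with ω h1
  rw [Real.enorm_of_nonneg h1.2.2.1]
  exact (ENNReal.ofReal_le_ofReal h1.2.2.2).trans ENNReal.ofReal_toReal_le

/-- `E_Q[-∑_{s ∈ 𝕋_t} γ_s X_s | ℱ_t]`. -/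
noncomputable def condLoss {Ω : Type*} {mΩ : MeasurableSpace Ω} (H : Horizon)
    (ℱ : Filtration ℕ mΩ) (Q : Measure Ω) (D : ℕ∞ → Ω → ℝ) (t : ℕ) (X : ℕ∞ → Ω → ℝ) : Ω → ℝ :=
  Q[fun ω => -gammaSum H D t X ω | ℱ t]

/-! ### Conditional losses and the one-step recursion for the penalties -/

section Penalty

variable {Ω : Type*} {mΩ : MeasurableSpace Ω} {H : Horizon} {ℱ : Filtration ℕ mΩ}
  {P Q : Measure Ω} {ρ : ℕ → (ℕ∞ → Ω → ℝ) → Ω → ℝ} {D : ℕ∞ → Ω → ℝ} {X Y Z : ℕ∞ → Ω → ℝ}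
  {t : ℕ}

theorem measurable_condLoss : Measurable[ℱ t] (condLoss H ℱ Q D t X) :=
  stronglyMeasurable_condExp.measurable

theorem condLoss_zero : condLoss H ℱ Q D t (fun _ _ => 0) = 0 := by
  rw [condLoss, gammaSum_zero]
  simp only [neg_zero]
  exact condExp_zero

theorem acceptanceSetOneStep_subset : acceptanceSetOneStep H ℱ P ρ t ⊆ acceptanceSet H ℱ P ρ t :=
  fun _ hX => ⟨hX.1.memRFrom, hX.2⟩

theorem integrable_condLoss : Integrable (condLoss H ℱ Q D t X) Q := integrable_condExp

theorem proj_mem_acceptanceSet (hρ : IsCondConvexRiskMeasure H ℱ P t (ρ t))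
    (hX : X ∈ acceptanceSet H ℱ P ρ t) : proj t H.last X ∈ acceptanceSet H ℱ P ρ t := by
  refine ⟨hX.1.1.memRFrom_proj, ?_⟩
  filter_upwards [hρ.riskOf_ae_eq hX.1, hX.2] with ω h1 h2
  exact h1.le.trans h2

theorem condLoss_proj : condLoss H ℱ Q D t (proj t H.last X) = condLoss H ℱ Q D t X := by
  have : gammaSum H D t (proj t H.last X) = gammaSum H D t X := by
    funext ω
    refine tsum_congr fun s => ?_
    rw [proj_last_apply_of_le s.2.1 s.2.2]
  rw [condLoss, condLoss, this]

/-- A member of `ℛ^∞_t` vanishes before `t` only almost surely, so multiplying it by an `ℱ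
t`-measurable weight could destroy adaptedness there. Projecting first makes it exactly zero. -/
theorem memR_mixture_proj (hX : MemR H ℱ P X) (hY : MemR H ℱ P Y) {l : Ω → ℝ}
    (hl : Measurable[ℱ t] l) (hl01 : ∀ ω, l ω = 0 ∨ l ω = 1) :
    MemR H ℱ P (fun s ω => l ω * proj t H.last X s ω + (1 - l ω) * proj t H.last Y s ω) := by
  have hX' := hX.memRFrom_proj (t := t)
  have hY' := hY.memRFrom_proj (t := t)
  obtain ⟨C, hC⟩ := hX'.1.2
  obtain ⟨C', hC'⟩ := hY'.1.2
  refine ⟨fun s hs => ?_, max C C', ?_⟩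
  · rcases lt_or_ge s (t : ℕ∞) with h | h
    · simp only [proj_last_apply_of_lt h, mul_zero, add_zero]
      exact measurable_const
    · have hl' : Measurable[sigmaAt ℱ s] l := hl.mono (le_iSup₂_of_le t h le_rfl) le_rfl
      exact (hl'.mul (hX'.1.1 s hs)).add ((measurable_const.sub hl').mul (hY'.1.1 s hs))
  · filter_upwards [hC, hC'] with ω h1 h2 s hs
    rcases hl01 ω with h | h
    · simpa [h] using Or.inr (h2 s hs)
    · simpa [h] using Or.inl (h1 s hs)

variable [IsFiniteMeasure Q]

theorem measurable_discPenalty (hD : IsDiscounting H ℱ P Q D) (ht : (t : ℕ∞) ∈ H.times) :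
    Measurable[ℱ t] (discPenalty H ℱ P ρ Q D t) := by
  have h1 := hD.measurable_nat ht
  refine h1.coe_real_ereal.mul (Measurable.ite (measurableSet_lt measurable_const h1) ?_
    measurable_const)
  refine (isEssSupFamily_essSupFamily (ℱ.le t) Q _ ?_).measurable
  rintro _ ⟨X, -, rfl⟩
  exact stronglyMeasurable_condExp.measurable.coe_real_ereal

theorem measurable_discPenaltyOneStep (hD : IsDiscounting H ℱ P Q D)
    (ht : (t : ℕ∞) ∈ H.times) : Measurable[ℱ t] (discPenaltyOneStep H ℱ P ρ Q D t) := by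
  have h1 := hD.measurable_nat ht
  refine h1.coe_real_ereal.mul (Measurable.ite (measurableSet_lt measurable_const h1) ?_
    measurable_const)
  refine (measurable_const.div h1).coe_real_ereal.mul
    (isEssSupFamily_essSupFamily (ℱ.le t) Q _ ?_).measurable
  rintro _ ⟨X, -, rfl⟩
  exact stronglyMeasurable_condExp.measurable.coe_real_ereal

variable [IsFiniteMeasure P]

/-- `D_t` is `ℱ t`-measurable and can be taken out. On `{D_t = 0}` the loss vanishes as well, being
bounded by a multiple of `D_t`, so the totalised division does no harm. -/
theorem condLoss_ae_eq_mul (hX : MemR H ℱ P X) (hD : IsDiscounting H ℱ P Q D)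
    (hQ : IsLocAbsCont H ℱ P Q) (ht : (t : ℕ∞) ∈ H.times) :
    ∀ᵐ ω ∂Q, condLoss H ℱ Q D t X ω =
      D t ω * (Q[fun ω'' => -∑' s : H.timesFrom t, gammaOf H D s ω'' / D t ω'' * X s ω'' | ℱ t])
        ω := by
  have h1 : (fun ω'' => -∑' s : H.timesFrom t, gammaOf H D s ω'' / D t ω'' * X s ω'') =
      fun ω => -(gammaSum H D t X ω / D t ω) := by
    funext ω
    rw [gammaSum, ← tsum_div_const]
    congr 1
    exact tsum_congr fun s => by ring
  rw [h1]
  obtain ⟨C, hC⟩ := hX.exists_ae_abs_gammaSum_le hD hQ ht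
  have h2 : (fun ω => -gammaSum H D t X ω) =ᵐ[Q]
      (D t) * fun ω => -(gammaSum H D t X ω / D t ω) := by
    filter_upwards [hC] with ω h3
    rw [Pi.mul_apply]
    rcases eq_or_ne (D t ω) 0 with h4 | h4
    · rw [h4, mul_zero] at h3
      rw [abs_nonpos_iff.1 h3, h4]
      simp
    · field_simp
  have h3 : Integrable ((D t) * fun ω => -(gammaSum H D t X ω / D t ω)) Q :=
    (hX.integrable_gammaSum hD hQ ht).neg.congr h2
  filter_upwards [condExp_congr_ae (m := ℱ t) h2, condExp_mul_of_stronglyMeasurable_left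
    (hD.measurable_nat ht).stronglyMeasurable h3 (hX.integrable_gammaSum_div hD hQ ht).neg]
    with ω h4 h5
  rw [condLoss, h4]
  exact h5

/-- The one-step conditional loss is the conditional loss of a process that is constant after
one step. -/
theorem condLoss_range (hX : MemRange H ℱ P t ((t + 1 : ℕ) : ℕ∞) X)
    (hD : IsDiscounting H ℱ P Q D) (hQ : IsLocAbsCont H ℱ P Q) (ht : (t : ℕ∞) < H.last) :
    Q[fun ω'' => -gammaOf H D t ω'' * X t ω'' - D (t + 1 : ℕ) ω'' * X (t + 1 : ℕ) ω'' | ℱ t]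
      =ᵐ[Q] condLoss H ℱ Q D t X := by
  refine condExp_congr_ae ?_
  filter_upwards [gammaSum_succ hX.1 hD hQ ht, gammaSum_range hX hD hQ ht] with ω h1 h2
  rw [h1, h2]
  ring

/-- Recursive structure of the conditional loss. -/
theorem condLoss_add (hX : MemR H ℱ P X) (hY : MemR H ℱ P Y) (hZ : MemRFrom H ℱ P (t + 1) Z)
    (h : ∀ s ∈ H.timesFrom t, X s =ᵐ[P] fun ω => Y s ω + Z s ω)
    (hD : IsDiscounting H ℱ P Q D) (hQ : IsLocAbsCont H ℱ P Q) (ht : (t : ℕ∞) < H.last) :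
    condLoss H ℱ Q D t X =ᵐ[Q]
      condLoss H ℱ Q D t Y + Q[condLoss H ℱ Q D (t + 1) Z | ℱ t] := by
  have ht0 := Horizon.times_of_lt_last ht
  have ht1 := Horizon.lt_last_iff.1 ht
  have hZ0 : ∀ᵐ ω ∂Q, Z t ω = 0 := by
    refine hQ.ae_of_ae ht0 (p := fun ω => Z t ω = 0) ?_
      (hZ.ae_eq_zero ht0 (by exact_mod_cast t.lt_succ_self))
    exact hZ.1.measurable_nat ht0 (measurableSet_singleton 0)
  have h1 : (fun ω => -gammaSum H D t X ω) =ᵐ[Q]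
      (fun ω => -gammaSum H D t Y ω) + fun ω => -gammaSum H D (t + 1) Z ω := by
    filter_upwards [gammaSum_congr hX (hY.add hZ.1) hD hQ h, gammaSum_add hY hZ.1 hD hQ ht0,
      gammaSum_succ hZ.1 hD hQ ht, hZ0] with ω h1 h2 h3 h4
    rw [Pi.add_apply, h1, h2, h3, h4]
    ring
  refine (condExp_congr_ae h1).trans ?_
  refine (condExp_add (hY.integrable_gammaSum hD hQ ht0).neg
    (hZ.1.integrable_gammaSum hD hQ ht1).neg (ℱ t)).trans ?_
  filter_upwards [condExp_condExp_of_le (μ := Q) (f := fun ω => -gammaSum H D (t + 1) Z ω)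
    (ℱ.mono t.le_succ) (ℱ.le (t + 1))] with ω h2
  rw [Pi.add_apply, Pi.add_apply, condLoss, condLoss, h2]
  rfl

theorem isEssSupFamily_discPenalty (hρ : IsCondConvexRiskMeasure H ℱ P t (ρ t))
    (hD : IsDiscounting H ℱ P Q D) (hQ : IsLocAbsCont H ℱ P Q) (ht : (t : ℕ∞) ∈ H.times) :
    IsEssSupFamily (ℱ t) Q
      ((fun X ω => (condLoss H ℱ Q D t X ω : EReal)) '' acceptanceSet H ℱ P ρ t)
      (discPenalty H ℱ P ρ Q D t) := by
  refine IsEssSupFamily.mul_real ⟨_, zero_mem_acceptanceSet hρ⟩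
    ((hD.measurable_nat ht).mono (ℱ.le t) le_rfl) (hD.nonneg t ht)
    (isEssSupFamily_essSupFamily (ℱ.le t) Q _ ?_)
    (fun X hX => condLoss_ae_eq_mul hX.1.1 hD hQ ht) (measurable_discPenalty hD ht)
    (fun ω h => ?_) fun ω h => ?_
  · rintro _ ⟨X, -, rfl⟩
    exact stronglyMeasurable_condExp.measurable.coe_real_ereal
  · rw [discPenalty, penalty, if_pos h]
  · rw [discPenalty, h, EReal.coe_zero, zero_mul]

theorem isEssSupFamily_discPenaltyOneStep (hρ : IsCondConvexRiskMeasure H ℱ P t (ρ t))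
    (hD : IsDiscounting H ℱ P Q D) (hQ : IsLocAbsCont H ℱ P Q) (ht : (t : ℕ∞) < H.last) :
    IsEssSupFamily (ℱ t) Q
      ((fun X ω => (condLoss H ℱ Q D t X ω : EReal)) '' acceptanceSetOneStep H ℱ P ρ t)
      (discPenaltyOneStep H ℱ P ρ Q D t) := by
  have ht0 := Horizon.times_of_lt_last ht
  have hU := isEssSupFamily_essSupFamily (ℱ.le t) Q
    ((fun (X : ℕ∞ → Ω → ℝ) (ω' : Ω) =>
          (((Q[fun ω'' => -gammaOf H D t ω'' * X t ω''
              - D (t + 1 : ℕ) ω'' * X (t + 1 : ℕ) ω'' | ℱ t]) ω' : ℝ) : EReal)) ''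
        acceptanceSetOneStep H ℱ P ρ t) (by
      rintro _ ⟨X, -, rfl⟩
      exact stronglyMeasurable_condExp.measurable.coe_real_ereal)
  refine IsEssSupFamily.congr_of_ne_zero ⟨_, zero_mem_acceptanceSetOneStep hρ⟩
    (hD.nonneg t ht0) (hU.congr_family fun X hX => ?_) (fun X hX => ?_)
    (measurable_discPenaltyOneStep hD ht0) (fun ω h => ?_) fun ω h => ?_
  · filter_upwards [condLoss_range hX.1 hD hQ ht] with ω h
    rw [h]
  · filter_upwards [condLoss_ae_eq_mul hX.1.1 hD hQ ht0] with ω h h'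
    rw [h, h', zero_mul]
  · rw [discPenaltyOneStep, penaltyOneStep, if_pos h, ← mul_assoc, ← EReal.coe_mul,
      mul_one_div_cancel h.ne', EReal.coe_one, one_mul]
  · rw [discPenaltyOneStep, h, EReal.coe_zero, zero_mul]

/-- The family of conditional losses of acceptable processes is upward directed. -/
theorem exists_condLoss_ge (hρ : IsCondConvexRiskMeasure H ℱ P t (ρ t))
    (hD : IsDiscounting H ℱ P Q D) (hQ : IsLocAbsCont H ℱ P Q) (ht : (t : ℕ∞) ∈ H.times)
    (hX : X ∈ acceptanceSet H ℱ P ρ t) (hY : Y ∈ acceptanceSet H ℱ P ρ t) :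
    ∃ Z ∈ acceptanceSet H ℱ P ρ t, condLoss H ℱ Q D t X ≤ᵐ[Q] condLoss H ℱ Q D t Z ∧
      condLoss H ℱ Q D t Y ≤ᵐ[Q] condLoss H ℱ Q D t Z := by
  classical
  -- Follow `X` where its loss is larger and `Y` elsewhere. Since `B` is in `ℱ t`, conditional
  -- convexity with weight `1_B` keeps the pasted process acceptable, and its loss is the maximum of
  -- the two.
  let B : Set Ω := {ω | condLoss H ℱ Q D t Y ω ≤ condLoss H ℱ Q D t X ω}
  have hB : MeasurableSet[ℱ t] B := 
    stronglyMeasurable_condExp.measurableSet_le stronglyMeasurable_condExp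
  let l : Ω → ℝ := B.indicator 1
  have hl : Measurable[ℱ t] l := (@measurable_const ℝ Ω _ (ℱ t) 1).indicator hB
  have hl1 : ∀ ω ∈ B, l ω = 1 := fun ω h => by simp [l, h]
  have hl0 : ∀ ω ∉ B, l ω = 0 := fun ω h => by simp [l, h]
  have hl01 : ∀ ω, l ω = 0 ∨ l ω = 1 := fun ω =>
    (em (ω ∈ B)).elim (fun h => Or.inr (hl1 ω h)) (fun h => Or.inl (hl0 ω h))
  have hZ := mixture_mem_acceptanceSet hρ (proj_mem_acceptanceSet hρ hX)
    (proj_mem_acceptanceSet hρ hY) hl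
    (fun ω => by rcases hl01 ω with h | h <;> simp [h]) (memR_mixture_proj hX.1.1 hY.1.1 hl hl01)
  have hiX := (hX.1.1.memRFrom_proj (t := t)).1.integrable_gammaSum hD hQ ht
  have hiY := (hY.1.1.memRFrom_proj (t := t)).1.integrable_gammaSum hD hQ ht
  set X' := proj t H.last X
  set Y' := proj t H.last Y
  have h1 : (fun ω => -gammaSum H D t (fun s ω => l ω * X' s ω + (1 - l ω) * Y' s ω) ω) =
      B.indicator (fun ω => -gammaSum H D t X' ω) +
        Bᶜ.indicator (fun ω => -gammaSum H D t Y' ω) := by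
    funext ω
    rw [gammaSum_mixture l ω (hl01 ω), Pi.add_apply]
    by_cases h : ω ∈ B
    · simp [h, hl1 ω h]
    · simp [h, hl0 ω h]
  have h2 : condLoss H ℱ Q D t (fun s ω => l ω * X' s ω + (1 - l ω) * Y' s ω) =ᵐ[Q]
      B.indicator (condLoss H ℱ Q D t X) + Bᶜ.indicator (condLoss H ℱ Q D t Y) := by
    rw [condLoss, h1, ← condLoss_proj (X := X), ← condLoss_proj (X := Y)]
    refine (condExp_add (hiX.neg.indicator (ℱ.le t _ hB))
      (hiY.neg.indicator (ℱ.le t _ hB.compl)) (ℱ t)).trans ?_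
    exact (condExp_indicator hiX.neg hB).add (condExp_indicator hiY.neg hB.compl)
  refine ⟨_, hZ, ?_, ?_⟩
  · filter_upwards [h2] with ω h2
    rw [h2, Pi.add_apply]
    by_cases h : ω ∈ B
    · simp [h]
    · simpa [h] using (not_le.1 h).le
  · filter_upwards [h2] with ω h2
    rw [h2, Pi.add_apply]
    by_cases h : ω ∈ B
    · refine le_trans (show _ ≤ condLoss H ℱ Q D t X ω from h) (le_of_eq ?_)
      simp [h]
    · simp [h]

theorem discPenalty_nonneg (hρ : IsCondConvexRiskMeasure H ℱ P t (ρ t))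
    (hD : IsDiscounting H ℱ P Q D) (hQ : IsLocAbsCont H ℱ P Q) (ht : (t : ℕ∞) ∈ H.times) :
    ∀ᵐ ω ∂Q, 0 ≤ discPenalty H ℱ P ρ Q D t ω := by
  filter_upwards [(isEssSupFamily_discPenalty hρ hD hQ ht).le _
    ⟨_, zero_mem_acceptanceSet hρ, rfl⟩] with ω h
  simpa [condLoss_zero] using h

theorem discPenaltyOneStep_nonneg (hρ : IsCondConvexRiskMeasure H ℱ P t (ρ t))
    (hD : IsDiscounting H ℱ P Q D) (hQ : IsLocAbsCont H ℱ P Q) (ht : (t : ℕ∞) < H.last) :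
    ∀ᵐ ω ∂Q, 0 ≤ discPenaltyOneStep H ℱ P ρ Q D t ω := by
  filter_upwards [(isEssSupFamily_discPenaltyOneStep hρ hD hQ ht).le _
    ⟨_, zero_mem_acceptanceSetOneStep hρ, rfl⟩] with ω h
  simpa [condLoss_zero] using h

theorem discPenaltyOneStep_le (hρ : IsCondConvexRiskMeasure H ℱ P t (ρ t))
    (hD : IsDiscounting H ℱ P Q D) (hQ : IsLocAbsCont H ℱ P Q) (ht : (t : ℕ∞) < H.last) :
    discPenaltyOneStep H ℱ P ρ Q D t ≤ᵐ[Q] discPenalty H ℱ P ρ Q D t := by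
  have ht0 := Horizon.times_of_lt_last ht
  refine (isEssSupFamily_discPenaltyOneStep hρ hD hQ ht).least _
    ((measurable_discPenalty hD ht0).mono (ℱ.le t) le_rfl) ?_
  rintro _ ⟨X, hX, rfl⟩
  exact (isEssSupFamily_discPenalty hρ hD hQ ht0).le _
    ⟨X, acceptanceSetOneStep_subset hX, rfl⟩

/-- The penalty vanishes at a finite horizon. -/
theorem discPenalty_last (hρ : IsCondConvexRiskMeasure H ℱ P t (ρ t))
    (hD : IsDiscounting H ℱ P Q D) (hQ : IsLocAbsCont H ℱ P Q) (ht : (t : ℕ∞) ∈ H.times)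
    (hlast : (t : ℕ∞) = H.last) : ∀ᵐ ω ∂Q, discPenalty H ℱ P ρ Q D t ω = 0 := by
  have h1 : discPenalty H ℱ P ρ Q D t ≤ᵐ[Q] fun _ => 0 := by
    refine (isEssSupFamily_discPenalty hρ hD hQ ht).least _ measurable_const ?_
    rintro _ ⟨X, hX, rfl⟩
    have hs : ∀ s ∈ H.timesFrom t, s = t := fun s hs =>
      le_antisymm ((Horizon.le_last hs.1).trans hlast.ge) hs.2
    have hc : MemLinfty (ℱ t) P (X t) := hX.1.1.memLinfty ht
    have h2 := hρ.riskOf_of_eq_add hX.1.1 memRFrom_zero hc fun s hs' => by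
      rw [hs s hs']
      simp
    -- At the horizon only `X_t` remains, so `ρ_t(X) = -X_t` and acceptability means `X_t ≥ 0`.
    have h3 : ∀ᵐ ω ∂P, 0 ≤ X t ω := by
      filter_upwards [h2, hρ.riskOf_ae_eq hX.1, hX.2, hρ.normalized] with ω h2 h3 h4 h5
      rw [h2, h5] at h3
      linarith
    have h4 : ∀ᵐ ω ∂Q, 0 ≤ X t ω :=
      hQ.ae_of_ae ht (p := fun ω => 0 ≤ X t ω) (hc.1 measurableSet_Ici) h3
    have h5 : condLoss H ℱ Q D t X ≤ᵐ[Q] Q[fun _ => (0 : ℝ) | ℱ t] := by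
      refine condExp_mono (hX.1.1.integrable_gammaSum hD hQ ht).neg (integrable_zero _ _ _) ?_
      filter_upwards [h4, hD.ae_isRegularPath] with ω h4 h5
      refine neg_nonpos.2 (tsum_nonneg fun s => mul_nonneg (h5.gammaOf_nonneg s.2.1) ?_)
      rw [hs s s.2]
      exact h4
    filter_upwards [h5] with ω h5
    rw [show (fun _ : Ω => (0 : ℝ)) = 0 from rfl, condExp_zero] at h5
    exact_mod_cast h5
  filter_upwards [h1, discPenalty_nonneg hρ hD hQ ht] with ω h1 h2 using le_antisymm h1 h2

/-- Step of the induction: finiteness and integrability pass from `D_t α_t` to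
`D_{t+1} α_{t+1}`, and `D_t α_t = D_t α_{t,t+1} + E_Q[D_{t+1} α_{t+1} | ℱ_t]`. -/
theorem discPenalty_succ (hρ : IsDynConvexRiskMeasure H ℱ P ρ) (htc : IsTimeConsistent H ℱ P ρ)
    (hD : IsDiscounting H ℱ P Q D) (hQ : IsLocAbsCont H ℱ P Q) (ht : (t : ℕ∞) < H.last)
    (hfin : ∀ᵐ ω ∂Q, discPenalty H ℱ P ρ Q D t ω < ⊤)
    (hint : Integrable (penaltyProcess H ℱ P ρ Q D t) Q) :
    (∀ᵐ ω ∂Q, discPenalty H ℱ P ρ Q D (t + 1) ω < ⊤) ∧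
      Integrable (penaltyProcess H ℱ P ρ Q D (t + 1)) Q ∧
      penaltyProcess H ℱ P ρ Q D t =ᵐ[Q]
        stepTerm H ℱ P ρ Q D t + Q[penaltyProcess H ℱ P ρ Q D (t + 1) | ℱ t] := by
  have ht0 := Horizon.times_of_lt_last ht
  have ht1 := Horizon.lt_last_iff.1 ht
  have hρ0 := hρ t ht0
  have hρ1 := hρ _ ht1
  have hE := isEssSupFamily_discPenalty hρ0 hD hQ ht0
  have hE1 := isEssSupFamily_discPenalty hρ1 hD hQ ht1
  have hES := isEssSupFamily_discPenaltyOneStep hρ0 hD hQ ht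
  have hV : ∀ᵐ ω ∂Q, discPenalty H ℱ P ρ Q D t ω = penaltyProcess H ℱ P ρ Q D t ω := by
    filter_upwards [hfin, discPenalty_nonneg hρ0 hD hQ ht0] with ω h1 h2
    exact (EReal.coe_toReal h1.ne (lt_of_lt_of_le (EReal.bot_lt_coe 0) h2).ne').symm
  have hS : ∀ᵐ ω ∂Q, discPenaltyOneStep H ℱ P ρ Q D t ω = stepTerm H ℱ P ρ Q D t ω := by
    filter_upwards [hfin, discPenaltyOneStep_nonneg hρ0 hD hQ ht,
      discPenaltyOneStep_le hρ0 hD hQ ht] with ω h1 h2 h3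
    rw [stepTerm, if_pos ht]
    exact (EReal.coe_toReal (h3.trans_lt h1).ne
      (lt_of_lt_of_le (EReal.bot_lt_coe 0) h2).ne').symm
  have hadd : ∀ Y ∈ acceptanceSetOneStep H ℱ P ρ t, ∀ Z ∈ acceptanceSet H ℱ P ρ (t + 1),
      condLoss H ℱ Q D t Y + Q[condLoss H ℱ Q D (t + 1) Z | ℱ t] ≤ᵐ[Q]
        penaltyProcess H ℱ P ρ Q D t := by
    intro Y hY Z hZ
    have hX := add_mem_acceptanceSet hρ htc ht hY hZ
    filter_upwards [condLoss_add hX.1.1 hY.1.1 hZ.1 (fun s _ => ae_eq_refl _) hD hQ ht,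
      hE.le _ ⟨_, hX, rfl⟩, hV] with ω h1 h2 h3
    rw [h3] at h2
    rw [← h1]
    exact EReal.coe_le_coe_iff.1 h2
  -- Starting from the zero process makes the increasing sequence of losses nonnegative, as monotone
  -- convergence requires.
  obtain ⟨f, hf0, hfS, hfmono, hfsup⟩ := hE1.exists_seq (ℱ.le _)
    (by rintro _ ⟨X, -, rfl⟩; exact measurable_condLoss.coe_real_ereal)
    (by
      rintro _ ⟨X, hX, rfl⟩ _ ⟨Y, hY, rfl⟩
      obtain ⟨Z, hZ, h1, h2⟩ := exists_condLoss_ge hρ1 hD hQ ht1 hX hY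
      refine ⟨_, ⟨Z, hZ, rfl⟩, ?_, ?_⟩
      · filter_upwards [h1] with ω h using EReal.coe_le_coe_iff.2 h
      · filter_upwards [h2] with ω h using EReal.coe_le_coe_iff.2 h)
    ⟨_, zero_mem_acceptanceSet hρ1, rfl⟩
  choose X hXA hXf using hfS
  have hmono : ∀ᵐ ω ∂Q, Monotone fun n => condLoss H ℱ Q D (t + 1) (X n) ω := by
    filter_upwards [ae_all_iff.2 hfmono] with ω h
    refine monotone_nat_of_le_succ fun n => EReal.coe_le_coe_iff.1 ?_
    have := h n
    rwa [← hXf n, ← hXf (n + 1)] at this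
  have hzero : 0 ≤ᵐ[Q] condLoss H ℱ Q D (t + 1) (X 0) := by
    refine Eventually.of_forall fun ω => ?_
    have h1 := congrFun ((hXf 0).trans hf0) ω
    beta_reduce at h1
    rw [condLoss_zero] at h1
    exact (EReal.coe_eq_coe_iff.1 h1).ge
  have hsup : ∀ᵐ ω ∂Q, ⨆ n, (condLoss H ℱ Q D (t + 1) (X n) ω : EReal) =
      discPenalty H ℱ P ρ Q D (t + 1) ω := by
    filter_upwards [hfsup] with ω h
    rw [← h]
    exact iSup_congr fun n => congrFun (hXf n) ω
  -- Pair `X n` with the acceptable one-step process `0`: its expected loss is at most `E_Q[D_t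
  -- α_t]`. This bound carries finiteness to time `t + 1`.
  have hK : ∀ n, ∫ ω, condLoss H ℱ Q D (t + 1) (X n) ω ∂Q ≤
      ∫ ω, penaltyProcess H ℱ P ρ Q D t ω ∂Q := by
    intro n
    rw [← integral_condExp (ℱ.le t)]
    refine integral_mono_ae integrable_condExp hint ?_
    have := hadd _ (zero_mem_acceptanceSetOneStep hρ0) _ (hXA n)
    rwa [condLoss_zero, zero_add] at this
  obtain ⟨hfin1, hint1, hlim1⟩ := ae_lt_top_of_monotone_of_integral_le
    (fun n => integrable_condLoss) hmono hzero hsup hK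
  have hlimE := tendsto_condExp_of_monotone (ℱ.le t) (fun n => integrable_condLoss) hint1
    hmono hlim1
  refine ⟨hfin1, hint1, ?_⟩
  have hm : Measurable (Q[penaltyProcess H ℱ P ρ Q D (t + 1) | ℱ t]) :=
    (stronglyMeasurable_condExp.mono (ℱ.le t)).measurable
  have hmV : Measurable (penaltyProcess H ℱ P ρ Q D t) :=
    ((measurable_discPenalty hD ht0).mono (ℱ.le t) le_rfl).ereal_toReal
  have hmS : Measurable (stepTerm H ℱ P ρ Q D t) := by
    have : stepTerm H ℱ P ρ Q D t = fun ω => (discPenaltyOneStep H ℱ P ρ Q D t ω).toReal :=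
      funext fun ω => if_pos ht
    rw [this]
    exact ((measurable_discPenaltyOneStep hD ht0).mono (ℱ.le t) le_rfl).ereal_toReal
  -- Fix `Y` and let the losses of `X n` increase to `D_{t+1} α_{t+1}` under the conditional
  -- expectation; only then take the supremum over `Y`.
  have hge : discPenaltyOneStep H ℱ P ρ Q D t ≤ᵐ[Q] fun ω =>
      ((penaltyProcess H ℱ P ρ Q D t ω - (Q[penaltyProcess H ℱ P ρ Q D (t + 1) | ℱ t]) ω : ℝ)
        : EReal) := by
    refine hES.least _ (hmV.sub hm).coe_real_ereal ?_
    rintro _ ⟨Y, hY, rfl⟩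
    filter_upwards [ae_all_iff.2 fun n => hadd Y hY _ (hXA n), hlimE] with ω h1 h2
    refine EReal.coe_le_coe_iff.2 (le_sub_iff_add_le.2 ?_)
    exact le_of_tendsto' (h2.const_add _) h1
  -- Conversely, split an acceptable `W` as `Y + Z` and bound each part by its own penalty.
  have hle : discPenalty H ℱ P ρ Q D t ≤ᵐ[Q] fun ω =>
      ((stepTerm H ℱ P ρ Q D t ω + (Q[penaltyProcess H ℱ P ρ Q D (t + 1) | ℱ t]) ω : ℝ)
        : EReal) := by
    refine hE.least _ (hmS.add hm).coe_real_ereal ?_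
    rintro _ ⟨W, hW, rfl⟩
    obtain ⟨Y, hY, Z, hZ, hWYZ⟩ := exists_add_of_mem_acceptanceSet hρ htc ht hW
    have hZle : condLoss H ℱ Q D (t + 1) Z ≤ᵐ[Q] penaltyProcess H ℱ P ρ Q D (t + 1) := by
      filter_upwards [hE1.le _ ⟨Z, hZ, rfl⟩, hfin1] with ω h1 h2
      exact EReal.coe_le_coe_iff.1 (h1.trans (EReal.le_coe_toReal h2.ne))
    filter_upwards [condLoss_add hW.1.1 hY.1.1 hZ.1 hWYZ hD hQ ht,
      condExp_mono (m := ℱ t) integrable_condLoss hint1 hZle, hES.le _ ⟨Y, hY, rfl⟩, hS]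
      with ω h1 h2 h3 h4
    rw [h4] at h3
    rw [h1]
    exact EReal.coe_le_coe_iff.2 (add_le_add (EReal.coe_le_coe_iff.1 h3) h2)
  filter_upwards [hge, hle, hV, hS] with ω h1 h2 h3 h4
  rw [h4] at h1
  rw [h3] at h2
  have h5 := EReal.coe_le_coe_iff.1 h1
  have h6 := EReal.coe_le_coe_iff.1 h2
  rw [Pi.add_apply]
  linarith

end Penalty

/-! ### The penalty process as a cost recursion -/

section PenaltyRecursion

variable {Ω : Type*} {mΩ : MeasurableSpace Ω} {H : Horizon} {ℱ : Filtration ℕ mΩ}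
  {P Q : Measure Ω} {ρ : ℕ → (ℕ∞ → Ω → ℝ) → Ω → ℝ} {D : ℕ∞ → Ω → ℝ}

open Classical in
/-- The process `D_t α_t`, extended by `0` beyond the horizon. -/
noncomputable def extendedPenalty (H : Horizon) (ℱ : Filtration ℕ mΩ) (P : Measure Ω)
    (ρ : ℕ → (ℕ∞ → Ω → ℝ) → Ω → ℝ) (Q : Measure Ω) (D : ℕ∞ → Ω → ℝ) (t : ℕ) : Ω → ℝ :=
  if (t : ℕ∞) ∈ H.times then penaltyProcess H ℱ P ρ Q D t else 0

theorem extendedPenalty_of_mem {t : ℕ} (ht : (t : ℕ∞) ∈ H.times) :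
    extendedPenalty H ℱ P ρ Q D t = penaltyProcess H ℱ P ρ Q D t :=
  if_pos ht

theorem extendedPenalty_of_notMem {t : ℕ} (ht : (t : ℕ∞) ∉ H.times) :
    extendedPenalty H ℱ P ρ Q D t = 0 :=
  if_neg ht

theorem stepTerm_of_lt {t : ℕ} (ht : (t : ℕ∞) < H.last) :
    stepTerm H ℱ P ρ Q D t = fun ω => (discPenaltyOneStep H ℱ P ρ Q D t ω).toReal :=
  funext fun _ => if_pos ht

theorem stepTerm_of_not_lt {t : ℕ} (ht : ¬ (t : ℕ∞) < H.last) :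
    stepTerm H ℱ P ρ Q D t = 0 :=
  funext fun _ => if_neg ht

variable [IsFiniteMeasure P] [IsFiniteMeasure Q]

theorem discPenalty_lt_top_and_integrable (hℱ0 : ℱ 0 = ⊥) (hρ : IsDynConvexRiskMeasure H ℱ P ρ)
    (htc : IsTimeConsistent H ℱ P ρ) (hQ : IsLocAbsCont H ℱ P Q) (hD : IsDiscounting H ℱ P Q D)
    (hα0 : ∀ᵐ ω ∂Q, penalty H ℱ P ρ Q D 0 ω < ⊤) (t : ℕ) (ht : (t : ℕ∞) ∈ H.times) :
    (∀ᵐ ω ∂Q, discPenalty H ℱ P ρ Q D t ω < ⊤) ∧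
      Integrable (penaltyProcess H ℱ P ρ Q D t) Q := by
  induction t with
  | zero =>
    refine ⟨?_, ?_⟩
    · filter_upwards [hα0] with ω h
      have h1 : D ((0 : ℕ) : ℕ∞) ω = 1 := hD.zero ω
      rwa [discPenalty, h1, EReal.coe_one, one_mul]
    · have h1 : StronglyMeasurable[⊥] (penaltyProcess H ℱ P ρ Q D 0) := by
        rw [← hℱ0]
        exact (measurable_discPenalty hD ht).ereal_toReal.stronglyMeasurable
      obtain ⟨c, hc⟩ := stronglyMeasurable_bot_iff.1 h1
      rw [hc]
      exact integrable_const c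
  | succ t ih =>
    obtain ⟨h1, h2⟩ := ih (Horizon.times_of_le ht t.le_succ)
    obtain ⟨h3, h4, -⟩ := discPenalty_succ hρ htc hD hQ (Horizon.lt_last_iff.2 ht) h1 h2
    exact ⟨h3, h4⟩

theorem isCostRecursion_extendedPenalty (hℱ0 : ℱ 0 = ⊥) (hρ : IsDynConvexRiskMeasure H ℱ P ρ)
    (htc : IsTimeConsistent H ℱ P ρ) (hQ : IsLocAbsCont H ℱ P Q) (hD : IsDiscounting H ℱ P Q D)
    (hα0 : ∀ᵐ ω ∂Q, penalty H ℱ P ρ Q D 0 ω < ⊤) :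
    IsCostRecursion ℱ Q (extendedPenalty H ℱ P ρ Q D) (stepTerm H ℱ P ρ Q D) := by
  have hV := discPenalty_lt_top_and_integrable hℱ0 hρ htc hQ hD hα0
  have hstepm : ∀ t, StronglyMeasurable[ℱ t] (stepTerm H ℱ P ρ Q D t) := by
    intro t
    by_cases ht : (t : ℕ∞) < H.last
    · rw [stepTerm_of_lt ht]
      exact (measurable_discPenaltyOneStep hD
        (Horizon.times_of_lt_last ht)).ereal_toReal.stronglyMeasurable
    · rw [stepTerm_of_not_lt ht]
      exact stronglyMeasurable_zero
  have hstep0 : ∀ t, 0 ≤ᵐ[Q] stepTerm H ℱ P ρ Q D t := by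
    intro t
    by_cases ht : (t : ℕ∞) < H.last
    · rw [stepTerm_of_lt ht]
      filter_upwards [discPenaltyOneStep_nonneg (hρ t (Horizon.times_of_lt_last ht)) hD hQ ht]
        with ω h using EReal.toReal_nonneg h
    · rw [stepTerm_of_not_lt ht]
  refine ⟨fun t => ?_, hstepm, fun t => ?_, fun t => ?_, fun t => ?_, hstep0, fun t => ?_⟩
  · by_cases ht : (t : ℕ∞) ∈ H.times
    · rw [extendedPenalty_of_mem ht]
      exact (measurable_discPenalty hD ht).ereal_toReal.stronglyMeasurable
    · rw [extendedPenalty_of_notMem ht]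
      exact stronglyMeasurable_zero
  · by_cases ht : (t : ℕ∞) ∈ H.times
    · rw [extendedPenalty_of_mem ht]
      exact (hV t ht).2
    · rw [extendedPenalty_of_notMem ht]
      exact integrable_zero _ _ _
  · by_cases ht : (t : ℕ∞) < H.last
    · have ht0 := Horizon.times_of_lt_last ht
      -- The one-step cost is dominated by the integrable `D_t α_t`, as one-step acceptable
      -- processes are acceptable.
      refine (hV t ht0).2.mono' ((hstepm t).mono (ℱ.le t)).aestronglyMeasurable ?_
      filter_upwards [hstep0 t, discPenaltyOneStep_le (hρ t ht0) hD hQ ht, (hV t ht0).1,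
        discPenaltyOneStep_nonneg (hρ t ht0) hD hQ ht] with ω h1 h2 h3 h4
      rw [Real.norm_of_nonneg h1, stepTerm_of_lt ht]
      exact EReal.toReal_le_toReal h2 (lt_of_lt_of_le (EReal.bot_lt_coe 0) h4).ne' h3.ne
    · rw [stepTerm_of_not_lt ht]
      exact integrable_zero _ _ _
  · by_cases ht : (t : ℕ∞) ∈ H.times
    · rw [extendedPenalty_of_mem ht]
      filter_upwards [discPenalty_nonneg (hρ t ht) hD hQ ht] with ω h using EReal.toReal_nonneg h
    · rw [extendedPenalty_of_notMem ht]
  · by_cases ht : (t : ℕ∞) < H.last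
    · have ht0 := Horizon.times_of_lt_last ht
      rw [extendedPenalty_of_mem ht0, extendedPenalty_of_mem (Horizon.lt_last_iff.1 ht)]
      exact (discPenalty_succ hρ htc hD hQ ht (hV t ht0).1 (hV t ht0).2).2.2
    -- At or beyond the horizon the right side is zero. The only case with content is `t = T`, where
    -- the penalty itself vanishes.
    · rw [extendedPenalty_of_notMem (fun h => ht (Horizon.lt_last_iff.2 h)),
        stepTerm_of_not_lt ht, condExp_zero, add_zero]
      by_cases ht0 : (t : ℕ∞) ∈ H.times
      · rw [extendedPenalty_of_mem ht0]
        have hlast : (t : ℕ∞) = H.last := (Horizon.eq_last_or_lt ht0).resolve_right ht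
        filter_upwards [discPenalty_last (hρ t ht0) hD hQ ht0 hlast] with ω h
        simp [penaltyProcess, h]
      · rw [extendedPenalty_of_notMem ht0]

end PenaltyRecursion

/-! ### Restriction to the time set and the proposition -/

theorem MeasureTheory.Martingale.natTime {Ω : Type*} {mΩ : MeasurableSpace Ω}
    {ℱ : Filtration ℕ mΩ} {Q : Measure Ω} {f : ℕ → Ω → ℝ} (h : Martingale f ℱ Q) (H : Horizon) :
    Martingale (fun t : H.NatTime => f t) (filtrationOn H ℱ) Q :=
  ⟨fun t => h.1 t, fun i j hij => h.2 i j hij⟩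

theorem MeasureTheory.Supermartingale.natTime {Ω : Type*} {mΩ : MeasurableSpace Ω}
    {ℱ : Filtration ℕ mΩ} {Q : Measure Ω} {f : ℕ → Ω → ℝ} (h : Supermartingale f ℱ Q)
    (H : Horizon) : Supermartingale (fun t : H.NatTime => f t) (filtrationOn H ℱ) Q :=
  ⟨fun t => h.1 t, fun i j hij => h.2.1 i j hij, fun t => h.2.2 t⟩

theorem proposition4p5 {Ω : Type*} {mΩ : MeasurableSpace Ω} (H : Horizon)
    (ℱ : Filtration ℕ mΩ) (hℱ0 : ℱ 0 = ⊥)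
    (P : Measure Ω) [IsProbabilityMeasure P]
    (ρ : ℕ → (ℕ∞ → Ω → ℝ) → Ω → ℝ)
    (hρ : IsDynConvexRiskMeasure H ℱ P ρ)
    (hcont : ∀ t : ℕ, (t : ℕ∞) ∈ H.times → IsContinuousFromAbove H ℱ P ρ t)
    (htc : IsTimeConsistent H ℱ P ρ)
    (Q : Measure Ω) [IsProbabilityMeasure Q] (hQ : IsLocAbsCont H ℱ P Q)
    (D : ℕ∞ → Ω → ℝ) (hD : IsDiscounting H ℱ P Q D)
    (hα0 : ∀ᵐ ω ∂Q, penalty H ℱ P ρ Q D 0 ω < ⊤) :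
    -- the discounted penalties are nonnegative and finite, hence given by their real versions
    (∀ t : ℕ, (t : ℕ∞) ∈ H.times →
      ∀ᵐ ω ∂Q, 0 ≤ discPenalty H ℱ P ρ Q D t ω ∧ discPenalty H ℱ P ρ Q D t ω < ⊤) ∧
    (∀ t : ℕ, (t : ℕ∞) < H.last →
      ∀ᵐ ω ∂Q, 0 ≤ discPenaltyOneStep H ℱ P ρ Q D t ω ∧
        discPenaltyOneStep H ℱ P ρ Q D t ω < ⊤) ∧
    -- the penalty process is a supermartingale and `M` is a martingale
    Supermartingale (fun t : H.NatTime => penaltyProcess H ℱ P ρ Q D t) (filtrationOn H ℱ) Q ∧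
    Martingale (fun t : H.NatTime => doobMartingale H ℱ P ρ Q D t) (filtrationOn H ℱ) Q ∧
    -- the total penalty converges and is integrable
    (∀ᵐ ω ∂Q, Summable (fun k => stepTerm H ℱ P ρ Q D k ω)) ∧
    Integrable (stepSumFrom H ℱ P ρ Q D 0) Q ∧
    -- the process `N`
    ∃ N : ℕ → Ω → ℝ,
      (∀ T : ℕ, H.last = T → ∀ t : H.NatTime, N t =ᵐ[Q] 0) ∧
      (H.last = ⊤ → ∀ t : ℕ, ∀ᵐ ω ∂Q,
        Tendsto (fun s : ℕ => (Q[penaltyProcess H ℱ P ρ Q D s | ℱ t]) ω) atTop (𝓝 (N t ω))) ∧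
      Martingale (fun t : H.NatTime => N t) (filtrationOn H ℱ) Q ∧
      (∀ t : H.NatTime, 0 ≤ᵐ[Q] N t) ∧
      -- the form of `M`
      (∀ t : H.NatTime, doobMartingale H ℱ P ρ Q D t =ᵐ[Q]
        Q[stepSumFrom H ℱ P ρ Q D 0 | ℱ t] + N t) ∧
      -- the Riesz decomposition into a potential and a martingale
      IsPotential H ℱ Q (fun t => Q[stepSumFrom H ℱ P ρ Q D t | ℱ t]) ∧
      (∀ t : H.NatTime, penaltyProcess H ℱ P ρ Q D t =ᵐ[Q]
        Q[stepSumFrom H ℱ P ρ Q D t | ℱ t] + N t) := by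
  have hR := isCostRecursion_extendedPenalty hℱ0 hρ htc hQ hD hα0
  have hfin := fun t ht => (discPenalty_lt_top_and_integrable hℱ0 hρ htc hQ hD hα0 t ht).1
  have hVfun : (fun t : H.NatTime => penaltyProcess H ℱ P ρ Q D t) =
      fun t : H.NatTime => extendedPenalty H ℱ P ρ Q D t :=
    funext fun t => (extendedPenalty_of_mem t.2).symm
  have hMfun : (fun t : H.NatTime => doobMartingale H ℱ P ρ Q D t) = fun t : H.NatTime =>
      fun ω => extendedPenalty H ℱ P ρ Q D t ω +
        ∑ k ∈ Finset.range t, stepTerm H ℱ P ρ Q D k ω :=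
    funext fun t => by rw [extendedPenalty_of_mem t.2]; rfl
  have hS0 : stepSumFrom H ℱ P ρ Q D 0 = fun ω => ∑' k, stepTerm H ℱ P ρ Q D k ω :=
    funext fun ω => by simp [stepSumFrom]
  have hnotMem : ∀ T : ℕ, H.last = T → ∀ s, T < s → ((s : ℕ) : ℕ∞) ∉ H.times := by
    intro T hT s hs h
    have h1 := Horizon.le_last h
    rw [hT] at h1
    exact absurd hs (not_lt.2 (by exact_mod_cast h1))
  refine ⟨fun t ht => ?_, fun t ht => ?_, ?_, ?_, hR.ae_summable, ?_,
    IsCostRecursion.martingalePart ℱ Q (extendedPenalty H ℱ P ρ Q D) (stepTerm H ℱ P ρ Q D),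
    fun T hT t => ?_, fun hT t => ?_, hR.martingale_martingalePart.natTime H,
    fun t => hR.martingalePart_nonneg t, fun t => ?_, ⟨hR.supermartingale_tail.natTime H,
    fun t => hR.tail_nonneg t, fun _ => hR.tendsto_integral_tail, fun T hT => ?_⟩, fun t => ?_⟩
  · filter_upwards [discPenalty_nonneg (hρ t ht) hD hQ ht, hfin t ht] with ω h1 h2 using ⟨h1, h2⟩
  · have ht0 := Horizon.times_of_lt_last ht
    filter_upwards [discPenaltyOneStep_nonneg (hρ t ht0) hD hQ ht, hfin t ht0,
      discPenaltyOneStep_le (hρ t ht0) hD hQ ht] with ω h1 h2 h3 using ⟨h1, h3.trans_lt h2⟩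
  · rw [hVfun]
    exact hR.supermartingale.natTime H
  · rw [hMfun]
    exact hR.martingale.natTime H
  · rw [hS0]
    exact hR.integrable_tsum
  -- Past a finite horizon the extended penalty is zero, so the limit that defines the martingale
  -- part is zero.
  · filter_upwards [hR.tendsto_martingalePart t] with ω h
    refine tendsto_nhds_unique h (tendsto_const_nhds.congr' ?_)
    filter_upwards [eventually_gt_atTop T] with s hs
    rw [extendedPenalty_of_notMem (hnotMem T hT s hs), condExp_zero]
  · filter_upwards [hR.tendsto_martingalePart t] with ω h
    refine h.congr fun s => ?_
    rw [extendedPenalty_of_mem]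
    cases H with
    | finite T => exact absurd hT (by simp [Horizon.last])
    | nat => exact ENat.natCast_ne_top s
    | natInfty => exact Set.mem_univ _
  · rw [congrFun hMfun t, hS0]
    refine Eventually.of_forall fun ω => ?_
    simp only [Pi.add_apply, IsCostRecursion.martingalePart, Pi.sub_apply]
    ring
  · have h1 : stepSumFrom H ℱ P ρ Q D T = 0 := by
      funext ω
      refine (tsum_congr fun k => ?_).trans tsum_zero
      split_ifs with hk
      · rw [stepTerm_of_not_lt (by rw [hT]; exact_mod_cast not_lt.2 hk)]
        rfl
      · rfl
    beta_reduce
    rw [h1, condExp_zero]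
  · rw [congrFun hVfun t]
    exact hR.riesz_decomposition t
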